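/- Let $R$ and $S$ be associative rings with unit. All modules are unitary; right $R$-modules are identified with left $R^{op}$-modules. A left module over a ring $A$ is *super finitely presented* if it has a projective resolution $\cdots\to P_1\to P_0\to F\to 0$ with every $P_i$ a finitely generated projective left $A$-module; for right modules the same definition is used over $A^{op}$. A left $A$-module $M$ is *weak injective* if $\operatorname{Ext}^1_A(F,M)=0$ for every super finitely presented left $A$-module $F$, and *weak flat* if $\operatorname{Tor}_1^A(F,M)=0$ for every super finitely presented right $A$-module $F$. Let $C={}_SC_R$ be a faithfully semidualizing $(S,R)$-bimodule, that is: ${}_SC$ and $C_R$ are super finitely presented; the homothety maps $S\to\operatorname{Hom}_{R^{op}}(C,C)$ and $R\to\operatorname{Hom}_S(C,C)$ are isomorphisms; $\operatorname{Ext}^i_S(C,C)=0=\operatorname{Ext}^i_{R^{op}}(C,C)$ for all $i\ge 1$; and, for all left $S$-modules $N$ and right $R$-modules $M$, $\operatorname{Hom}_S(C,N)=0$ implies $N=0$ and $\operatorname{Hom}_{R^{op}}(C,M)=0$ implies $M=0$. The *Auslander class* $\mathcal A_C(R)$ consists of the left $R$-modules $M$ with $\operatorname{Tor}^R_i(C,M)=0=\operatorname{Ext}^i_S(C,C\otimes_RM)$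 for all $i\ge1$ for which the evaluation map $M\to\operatorname{Hom}_S(C,C\otimes_RM)$, $m\mapsto(c\mapsto c\otimes m)$, is an isomorphism. The *Bass class* $\mathcal B_C(S)$ consists of the left $S$-modules $N$ with $\operatorname{Ext}^i_S(C,N)=0=\operatorname{Tor}^R_i(C,\operatorname{Hom}_S(C,N))$ for all $i\ge1$ for which the evaluation map $C\otimes_R\operatorname{Hom}_S(C,N)\to N$, $c\otimes f\mapsto f(c)$, is an isomorphism. A left $S$-module is *$C$-weak flat* if it is isomorphic to $C\otimes_RF$ for some weak flat left $R$-module $F$; a left $R$-module is *$C$-weak injective* if it is isomorphic to $\operatorname{Hom}_S(C,I)$ for some weak injective left $S$-module $I$. **Proposition 2.4.** Let $V$ be a left $S$-module and $U$ a left $R$-module. 1. $V$ is $C$-weak flat if and only if $V\in\mathcal B_C(S)$ and $\operatorname{Hom}_S(C,V)$ is a weak flat left $R$-module. 2. $U$ is $C$-weak injective if and only if $U\in\mathcal A_C(R)$ and $C\otimes_RU$ is a weak injective left $S$-module. -/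

import Mathlib

/-!
Right `R`-modules are modules over `Rᵐᵒᵖ`, so that `x r` is written `MulOpposite.op r • x`, and an
`(S, R)`-bimodule `C` carries `[Module S C] [Module Rᵐᵒᵖ C] [SMulCommClass S Rᵐᵒᵖ C]`.
The rings are arbitrary associative unital rings.
-/

open CategoryTheory
open scoped TensorProduct

universe u

namespace WeakFoxby

section Tensor

variable (R : Type u) [Ring R]

/-- The subgroup of `N ⊗_ℤ M` generated by all `(x r) ⊗ m - x ⊗ (r m)`. -/
def balancedRel (N M : Type u) [AddCommGroup N] [Module Rᵐᵒᵖ N] [AddCommGroup M] [Module R M] :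
    Submodule ℤ (N ⊗[ℤ] M) :=
  Submodule.span ℤ {t | ∃ (x : N) (r : R) (m : M),
    t = (MulOpposite.op r • x) ⊗ₜ[ℤ] m - x ⊗ₜ[ℤ] (r • m)}

/-- The tensor product `N ⊗_R M` of a right `R`-module and a left `R`-module over a ring `R` that
need not be commutative. -/
def Tensor (N M : Type u) [AddCommGroup N] [Module Rᵐᵒᵖ N] [AddCommGroup M] [Module R M] :
    Type u :=
  (N ⊗[ℤ] M) ⧸ balancedRel R N M

variable {N N' N'' M M' : Type u} [AddCommGroup N] [Module Rᵐᵒᵖ N] [AddCommGroup N']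
  [Module Rᵐᵒᵖ N'] [AddCommGroup N''] [Module Rᵐᵒᵖ N''] [AddCommGroup M] [Module R M]
  [AddCommGroup M'] [Module R M']

noncomputable instance : AddCommGroup (Tensor R N M) :=
  inferInstanceAs (AddCommGroup ((N ⊗[ℤ] M) ⧸ balancedRel R N M))

namespace Tensor

/-- The pure tensor `x ⊗ m` in `N ⊗_R M`. -/
def tmul (x : N) (m : M) : Tensor R N M := (balancedRel R N M).mkQ (x ⊗ₜ[ℤ] m)

theorem add_tmul (x y : N) (m : M) : tmul R (x + y) m = tmul R x m + tmul R y m :=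
  (congrArg (balancedRel R N M).mkQ (TensorProduct.add_tmul x y m)).trans (map_add _ _ _)

theorem tmul_add (x : N) (m n : M) : tmul R x (m + n) = tmul R x m + tmul R x n :=
  (congrArg (balancedRel R N M).mkQ (TensorProduct.tmul_add x m n)).trans (map_add _ _ _)

theorem smul_tmul (r : R) (x : N) (m : M) :
    tmul R (MulOpposite.op r • x) m = tmul R x (r • m) :=
  (Submodule.Quotient.eq _).2 (Submodule.subset_span ⟨x, r, m, rfl⟩)

variable {R} in
@[elab_as_elim]
theorem induction_on {p : Tensor R N M → Prop} (t : Tensor R N M) (zero : p 0)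
    (tmul : ∀ x m, p (tmul R x m)) (add : ∀ a b, p a → p b → p (a + b)) : p t := by
  obtain ⟨t, rfl⟩ := Submodule.mkQ_surjective (balancedRel R N M) t
  induction t using TensorProduct.induction_on with
  | zero => exact (map_zero (balancedRel R N M).mkQ).symm ▸ zero
  | tmul x m => exact tmul x m
  | add a b ha hb => exact (map_add (balancedRel R N M).mkQ a b).symm ▸ add _ _ ha hb

variable {R} in
theorem addHom_ext {A : Type*} [AddCommGroup A] {f g : Tensor R N M →+ A}
    (h : ∀ x m, f (tmul R x m) = g (tmul R x m)) : f = g := by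
  ext t
  induction t using induction_on with
  | zero => simp
  | tmul x m => exact h x m
  | add a b ha hb => rw [map_add, map_add, ha, hb]

variable {R} in
/-- The universal property: a biadditive balanced map induces an additive map on `N ⊗_R M`. -/
noncomputable def lift {A : Type*} [AddCommGroup A] (f : N →+ M →+ A)
    (hf : ∀ (x : N) (r : R) (m : M), f (MulOpposite.op r • x) m = f x (r • m)) :
    Tensor R N M →+ A :=
  ((balancedRel R N M).liftQ (TensorProduct.liftAddHom f (fun n x m => by simp)).toIntLinearMap (by
    refine Submodule.span_le.2 ?_
    rintro _ ⟨x, r, m, rfl⟩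
    simp [hf])).toAddMonoidHom

variable {R} in
@[simp]
theorem lift_tmul {A : Type*} [AddCommGroup A] (f : N →+ M →+ A)
    (hf : ∀ (x : N) (r : R) (m : M), f (MulOpposite.op r • x) m = f x (r • m)) (x : N) (m : M) :
    lift f hf (tmul R x m) = f x m := rfl

/-- The additive map `f ⊗_R M : N ⊗_R M → N' ⊗_R M`. -/
noncomputable def mapLeft (M : Type u) [AddCommGroup M] [Module R M] (f : N →ₗ[Rᵐᵒᵖ] N') :
    Tensor R N M →+ Tensor R N' M :=
  lift (AddMonoidHom.mk' (fun x => AddMonoidHom.mk' (fun m => tmul R (f x) m)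
      (fun m n => tmul_add R (f x) m n))
      (fun x y => by ext m; exact (congrArg (tmul R · m) (map_add f x y)).trans (add_tmul R _ _ _)))
    (fun x r m => by
      change tmul R (f (MulOpposite.op r • x)) m = tmul R (f x) (r • m)
      rw [map_smul, smul_tmul])

@[simp]
theorem mapLeft_tmul (f : N →ₗ[Rᵐᵒᵖ] N') (x : N) (m : M) :
    mapLeft R M f (tmul R x m) = tmul R (f x) m := rfl

section Bimodule

variable (S : Type u) [Ring S] [Module S N] [SMulCommClass S Rᵐᵒᵖ N]

/-- The ring homomorphism `S → End_ℤ (N ⊗_R M)`, `s ↦ (x ⊗ m ↦ (s x) ⊗ m)`. -/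
noncomputable def actionHom : S →+* AddMonoid.End (Tensor R N M) where
  toFun s := mapLeft R M (Module.toModuleEnd Rᵐᵒᵖ N s)
  map_one' := addHom_ext fun x m => congrArg (fun y : N => tmul R y m) (one_smul S x)
  map_mul' s t := addHom_ext fun x m => congrArg (fun y : N => tmul R y m) (mul_smul s t x)
  map_zero' := addHom_ext fun x m => by
    have h : tmul R ((0 : S) • x) m = 0 := by
      have h0 := add_tmul R (0 : N) 0 m
      rw [zero_smul]
      simpa using h0
    exact h
  map_add' s t := addHom_ext fun x m =>
    (congrArg (fun y : N => tmul R y m) (add_smul s t x)).trans (add_tmul R _ _ _)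

/-- For an `(S, R)`-bimodule `N`, the left `S`-module structure on `N ⊗_R M`. -/
noncomputable instance : Module S (Tensor R N M) :=
  Module.compHom _ (actionHom R (N := N) (M := M) S)

@[simp]
theorem smul_tmul' (s : S) (x : N) (m : M) : s • tmul R x m = tmul R (s • x) m := rfl

end Bimodule

end Tensor

/-- The functor `- ⊗_R M` from right `R`-modules to abelian groups. -/
noncomputable def tensorFunctor (M : Type u) [AddCommGroup M] [Module R M] :
    ModuleCat.{u} Rᵐᵒᵖ ⥤ AddCommGrpCat.{u} where
  obj N := AddCommGrpCat.of (Tensor R N M)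
  map f := AddCommGrpCat.ofHom (Tensor.mapLeft R M f.hom)
  map_id _ := by
    ext1
    exact Tensor.addHom_ext fun _ _ => rfl
  map_comp _ _ := by
    ext1
    exact Tensor.addHom_ext fun _ _ => rfl

instance (M : Type u) [AddCommGroup M] [Module R M] : (tensorFunctor R M).Additive where
  map_add := by
    intro X Y f g
    ext1
    exact Tensor.addHom_ext fun x m => Tensor.add_tmul R (f.hom x) (g.hom x) m

/-- `Tor_n^R(N, M)`, the `n`-th left derived functor of `- ⊗_R M` at the right module `N`. -/
noncomputable def Tor (n : ℕ) (N M : Type u) [AddCommGroup N] [Module Rᵐᵒᵖ N] [AddCommGroup M]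
    [Module R M] : AddCommGrpCat.{u} :=
  ((tensorFunctor R M).leftDerived n).obj (ModuleCat.of Rᵐᵒᵖ N)

/-- `Ext^n_R(M, M')` for left `R`-modules. -/
abbrev ExtMod (n : ℕ) (M M' : Type u) [AddCommGroup M] [Module R M] [AddCommGroup M']
    [Module R M'] : Type u :=
  Abelian.Ext (ModuleCat.of R M) (ModuleCat.of R M') n

/-- `M` admits a projective resolution by finitely generated projective modules. -/
def SuperFinitelyPresented (M : Type u) [AddCommGroup M] [Module R M] : Prop :=
  ∃ P : ProjectiveResolution (ModuleCat.of R M), ∀ n : ℕ, Module.Finite R (P.complex.X n)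

/-- `Ext^1_R(F, M) = 0` for all super finitely presented left `R`-modules `F`. -/
def WeakInjective (M : Type u) [AddCommGroup M] [Module R M] : Prop :=
  ∀ (F : Type u) [AddCommGroup F] [Module R F],
    SuperFinitelyPresented R F → Subsingleton (ExtMod R 1 F M)

/-- The left `R`-module `M` satisfies `Tor_1^R(F, M) = 0` for all super finitely presented right
`R`-modules `F`. -/
def WeakFlat (M : Type u) [AddCommGroup M] [Module R M] : Prop :=
  ∀ (F : Type u) [AddCommGroup F] [Module Rᵐᵒᵖ F],
    SuperFinitelyPresented Rᵐᵒᵖ F → Subsingleton (Tor R 1 F M)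

end Tensor

section Bimodule

variable (R S : Type u) [Ring R] [Ring S]
  (C : Type u) [AddCommGroup C] [Module S C] [Module Rᵐᵒᵖ C] [SMulCommClass S Rᵐᵒᵖ C]

/-- `Hom_S(C, N)`, with the left `R`-module structure `(r f)(x) = f (x r)` defined below. It is a
type synonym, with `R` as a label, so that no other module structure on linear maps interferes. -/
def HomMod (_R S : Type u) [Ring S] (C : Type u) [AddCommGroup C] [Module S C] (N : Type u)
    [AddCommGroup N] [Module S N] : Type u :=
  C →ₗ[S] N

/-- An element of `Hom_S(C, N)` as a linear map. -/
def HomMod.toLin {R S C : Type u} [Ring S] [AddCommGroup C] [Module S C] {N : Type u}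
    [AddCommGroup N] [Module S N] (f : HomMod R S C N) : C →ₗ[S] N := f

/-- The homothety map `S → Hom_{Rᵒᵖ}(C, C)`, `s ↦ (x ↦ s x)`. -/
def homothetyLeft : S →+* Module.End Rᵐᵒᵖ C := Module.toModuleEnd Rᵐᵒᵖ C

/-- The homothety map `R → Hom_S(C, C)`, `r ↦ (x ↦ x r)`. With composition of endomorphisms as
multiplication it is a ring homomorphism on `Rᵐᵒᵖ`. -/
def homothetyRight : Rᵐᵒᵖ →+* Module.End S C :=
  haveI := SMulCommClass.symm S Rᵐᵒᵖ C
  Module.toModuleEnd S C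

theorem homothetyLeft_apply (s : S) (x : C) : homothetyLeft R S C s x = s • x := rfl

theorem homothetyRight_apply (r : R) (x : C) :
    homothetyRight R S C (MulOpposite.op r) x = MulOpposite.op r • x := rfl

noncomputable instance (N : Type u) [AddCommGroup N] [Module S N] :
    AddCommGroup (HomMod R S C N) :=
  inferInstanceAs (AddCommGroup (C →ₗ[S] N))

noncomputable instance (N : Type u) [AddCommGroup N] [Module S N] : Module R (HomMod R S C N) where
  smul r f := f.toLin.comp (homothetyRight R S C (MulOpposite.op r))
  one_smul f := LinearMap.ext fun x => congrArg f.toLin (one_smul Rᵐᵒᵖ x)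
  mul_smul r s f := LinearMap.ext fun x => congrArg f.toLin
    (mul_smul (MulOpposite.op s) (MulOpposite.op r) x)
  smul_zero _ := LinearMap.ext fun _ => rfl
  smul_add _ _ _ := LinearMap.ext fun _ => rfl
  add_smul r s f := LinearMap.ext fun x =>
    (congrArg f.toLin (add_smul (MulOpposite.op r) (MulOpposite.op s) x)).trans
      (map_add f.toLin _ _)
  zero_smul f := LinearMap.ext fun x =>
    (congrArg f.toLin (zero_smul Rᵐᵒᵖ x)).trans (map_zero f.toLin)

theorem HomMod.smul_apply (N : Type u) [AddCommGroup N] [Module S N] (r : R)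
    (f : HomMod R S C N) (x : C) : (r • f).toLin x = f.toLin (MulOpposite.op r • x) := rfl

/-- The evaluation `μ_M : M → Hom_S(C, C ⊗_R M)`, `m ↦ (x ↦ x ⊗ m)`. -/
noncomputable def unitMap (M : Type u) [AddCommGroup M] [Module R M] :
    M →ₗ[R] HomMod R S C (Tensor R C M) where
  toFun m := show C →ₗ[S] Tensor R C M from
    { toFun := fun x => Tensor.tmul R x m
      map_add' := fun x y => Tensor.add_tmul R x y m
      map_smul' := fun _ _ => rfl }
  map_add' m n := LinearMap.ext fun x => Tensor.tmul_add R x m n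
  map_smul' r m := LinearMap.ext fun x => (Tensor.smul_tmul R r x m).symm

/-- The evaluation `ν_N : C ⊗_R Hom_S(C, N) → N`, `x ⊗ f ↦ f x`. -/
noncomputable def counitMap (N : Type u) [AddCommGroup N] [Module S N] :
    Tensor R C (HomMod R S C N) →ₗ[S] N where
  toAddHom := (Tensor.lift (R := R)
    (AddMonoidHom.mk' (fun x : C => AddMonoidHom.mk' (fun f : HomMod R S C N => f.toLin x)
      (fun _ _ => rfl))
      (fun x y => by ext f; exact map_add f.toLin x y))
    (fun _ _ _ => rfl)).toAddHom
  map_smul' s t := by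
    change Tensor.lift (R := R) _ _ (s • t) = s • Tensor.lift (R := R) _ _ t
    induction t using Tensor.induction_on with
    | zero => rw [smul_zero, map_zero, smul_zero]
    | tmul x f => exact map_smul f.toLin s x
    | add a b ha hb => rw [smul_add, map_add, map_add, smul_add, ha, hb]

theorem unitMap_apply (M : Type u) [AddCommGroup M] [Module R M] (m : M) (x : C) :
    (unitMap R S C M m).toLin x = Tensor.tmul R x m := rfl

theorem counitMap_tmul (N : Type u) [AddCommGroup N] [Module S N] (x : C) (f : HomMod R S C N) :
    counitMap R S C N (Tensor.tmul R x f) = f.toLin x := rfl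

/-- The `(S, R)`-bimodule `C` is semidualizing. -/
structure Semidualizing : Prop where
  left_resolution : SuperFinitelyPresented S C
  right_resolution : SuperFinitelyPresented Rᵐᵒᵖ C
  homothety_left : Function.Bijective (homothetyLeft R S C)
  homothety_right : Function.Bijective (homothetyRight R S C)
  ext_left : ∀ i : ℕ, 1 ≤ i → Subsingleton (ExtMod S i C C)
  ext_right : ∀ i : ℕ, 1 ≤ i → Subsingleton (ExtMod Rᵐᵒᵖ i C C)

/-- The `(S, R)`-bimodule `C` is faithfully semidualizing. -/
structure FaithfullySemidualizing : Prop extends Semidualizing R S C where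
  faithful_left : ∀ (N : Type u) [AddCommGroup N] [Module S N],
    Subsingleton (C →ₗ[S] N) → Subsingleton N
  faithful_right : ∀ (M : Type u) [AddCommGroup M] [Module Rᵐᵒᵖ M],
    Subsingleton (C →ₗ[Rᵐᵒᵖ] M) → Subsingleton M

/-- The left `R`-module `M` belongs to the Auslander class `A_C(R)`. -/
structure InAuslander (M : Type u) [AddCommGroup M] [Module R M] : Prop where
  tor_eq_zero : ∀ i : ℕ, 1 ≤ i → Subsingleton (Tor R i C M)
  ext_eq_zero : ∀ i : ℕ, 1 ≤ i → Subsingleton (ExtMod S i C (Tensor R C M))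
  unit_bijective : Function.Bijective (unitMap R S C M)

/-- The left `S`-module `N` belongs to the Bass class `B_C(S)`. -/
structure InBass (N : Type u) [AddCommGroup N] [Module S N] : Prop where
  ext_eq_zero : ∀ i : ℕ, 1 ≤ i → Subsingleton (ExtMod S i C N)
  tor_eq_zero : ∀ i : ℕ, 1 ≤ i → Subsingleton (Tor R i C (HomMod R S C N))
  counit_bijective : Function.Bijective (counitMap R S C N)

/-- The left `S`-module `V` has the form `C ⊗_R F` for a weak flat left `R`-module `F`. -/
def CWeakFlat (V : Type u) [AddCommGroup V] [Module S V] : Prop :=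
  ∃ (F : Type u) (_ : AddCommGroup F) (_ : Module R F),
    WeakFlat R F ∧ Nonempty (V ≃ₗ[S] Tensor R C F)

/-- The left `R`-module `U` has the form `Hom_S(C, I)` for a weak injective left `S`-module `I`. -/
def CWeakInjective (U : Type u) [AddCommGroup U] [Module R U] : Prop :=
  ∃ (I : Type u) (_ : AddCommGroup I) (_ : Module S I),
    WeakInjective S I ∧ Nonempty (U ≃ₗ[R] HomMod R S C I)

end Bimodule

end WeakFoxby

/-! Everything reduces to two inclusions: weak flat modules lie in the Auslander class
(`WeakFlat.inAuslander`) and weak injective modules lie in the Bass class (`WeakInjective.inBass`).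
Given these, if `V ≅ C ⊗ F` then the unit identifies `F` with `Hom_S(C, V)`, the Ext and Tor
conditions on `F` become those on `V`, and the counit of `V` is bijective by a triangle identity;
part 2 is symmetric. The converses are immediate, since bijectivity of the counit or unit exhibits
the required form.

For the inclusions, the device is `Dualizable`: modules `X` such that `X` and `X* = Hom(X, C)` are
super finitely presented and all higher `Ext(X, C)` vanish. `C` is dualizable, because its dual is
the other ring by the homothety isomorphism. If `X` is dualizable, it has a finite free cover with
dualizable kernel `K`, because `0 → X* → Cⁿ → K* → 0` is exact and super finitely presented modules
are closed under cokernels of injections.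

For `F` weak flat, `Tor_1(K*, F) = 0`, so this sequence stays exact after tensoring with `F`.
Comparing it with `Hom(-, C ⊗ F)` applied to the cover shows that `X* ⊗ F → Hom(X, C ⊗ F)` is
bijective. Applied to `K`, this extends every map `K → C ⊗ F` to the free module, so `Ext^1(X, C ⊗
F) = 0`, and dimension shifting gives the higher degrees. Taking `X = C` gives the unit isomorphism.
For `I` weak injective, the same argument with `Ext^1(K*, I) = 0` treats `X ⊗ Hom(C, I) → Hom(X*,
I)`, the vanishing of Tor and the counit. -/

namespace WeakFoxby

/-! ### Building and splicing projective resolutions -/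

section Resolution

variable {A : Type u} [Ring A]

/-- An exact sequence `⋯ → P 1 → P 0 → M → 0` with projective terms, as a projective
resolution. -/
noncomputable def resolutionOfSequence {M : ModuleCat.{u} A} (P : ℕ → ModuleCat.{u} A)
    (hP : ∀ n, Projective (P n)) (d : ∀ n, P (n + 1) ⟶ P n) (π : P 0 ⟶ M)
    (hd : ∀ n, Function.Exact (d (n + 1)).hom (d n).hom) (h0 : Function.Exact (d 0).hom π.hom)
    (hπ : Function.Surjective π.hom) : ProjectiveResolution M where
  complex := ChainComplex.of P d fun n => by
    ext x
    exact (hd n).apply_apply_eq_zero x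
  projective n := hP n
  π := (ChainComplex.toSingle₀Equiv _ _).symm ⟨π, by
    change ChainComplex.of.d P d 1 0 ≫ π = 0
    rw [show ChainComplex.of.d P d 1 0 = d 0 from ChainComplex.of_d P d 0]
    ext x
    exact h0.apply_apply_eq_zero x⟩
  quasiIso := ⟨fun n => by
    cases n with
    | zero =>
      rw [ChainComplex.quasiIsoAt₀_iff, ShortComplex.quasiIso_iff_of_zeros']
      · have hw : d 0 ≫ π = 0 := by
          ext x
          exact h0.apply_apply_eq_zero x
        refine (ShortComplex.exact_and_epi_g_iff_of_iso (S₂ := ShortComplex.mk (d 0) π hw) ?_).2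
          ⟨(ShortComplex.ShortExact.moduleCat_exact_iff_function_exact _).2 h0,
            (ModuleCat.epi_iff_surjective _).2 hπ⟩
        -- Identities in all three places: the isomorphism only replaces the packaged differential
        -- and augmentation by `d 0` and `π`.
        refine ShortComplex.isoMk (Iso.refl _) (Iso.refl _) (Iso.refl _) ?_ ?_
        · exact (Category.id_comp _).trans
            ((ChainComplex.of_d P d 0).symm.trans (Category.comp_id _).symm)
        · refine (Category.id_comp π).trans (Eq.trans ?_ (Category.comp_id _).symm)
          exact (ChainComplex.toSingle₀Equiv_symm_apply_f_zero (C := ChainComplex.of P d _)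
            (X := M) π _).symm
      all_goals rfl
    | succ n =>
      rw [quasiIsoAt_iff_exactAt']
      · rw [HomologicalComplex.exactAt_iff' _ (n + 1 + 1) (n + 1) n (by simp) (by simp),
          ShortComplex.ShortExact.moduleCat_exact_iff_function_exact]
        change Function.Exact (ChainComplex.of.d P d (n + 1 + 1) (n + 1)).hom
          (ChainComplex.of.d P d (n + 1) n).hom
        rw [ChainComplex.of_d, ChainComplex.of_d]
        exact hd n
      · apply ChainComplex.exactAt_succ_single_obj⟩

theorem resolutionOfSequence_d {M : ModuleCat.{u} A} (P : ℕ → ModuleCat.{u} A)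
    (hP : ∀ n, Projective (P n)) (d : ∀ n, P (n + 1) ⟶ P n) (π : P 0 ⟶ M)
    (hd : ∀ n, Function.Exact (d (n + 1)).hom (d n).hom) (h0 : Function.Exact (d 0).hom π.hom)
    (hπ : Function.Surjective π.hom) (n : ℕ) :
    (resolutionOfSequence P hP d π hd h0 hπ).complex.d (n + 1) n = d n :=
  ChainComplex.of_d P d n

theorem resolution_exact_succ {M : ModuleCat.{u} A} (Q : ProjectiveResolution M) (n : ℕ) :
    Function.Exact (Q.complex.d (n + 1 + 1) (n + 1)).hom (Q.complex.d (n + 1) n).hom :=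
  (ShortComplex.ShortExact.moduleCat_exact_iff_function_exact _).1 (Q.exact_succ n)

/-- The augmentation of a projective resolution. -/
noncomputable def augmentation {M : ModuleCat.{u} A} (Q : ProjectiveResolution M) :
    Q.complex.X 0 ⟶ M := Q.π.f 0

theorem augmentation_exact {M : ModuleCat.{u} A} (Q : ProjectiveResolution M) :
    Function.Exact (Q.complex.d 1 0).hom (augmentation Q).hom :=
  (ShortComplex.ShortExact.moduleCat_exact_iff_function_exact _).1 Q.exact₀

theorem augmentation_surjective {M : ModuleCat.{u} A} (Q : ProjectiveResolution M) :
    Function.Surjective (augmentation Q).hom :=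
  (ModuleCat.epi_iff_surjective _).1 (inferInstanceAs (Epi (Q.π.f 0)))

/-- A projective resolution of the kernel of a surjection `p : P → M` with `P` projective, extended
to a projective resolution of `M`. -/
noncomputable def extendResolution {P M : Type u} [AddCommGroup P] [Module A P] [AddCommGroup M]
    [Module A M] [Module.Projective A P] (p : P →ₗ[A] M) (hp : Function.Surjective p)
    (Q : ProjectiveResolution (ModuleCat.of A (LinearMap.ker p))) :
    ProjectiveResolution (ModuleCat.of A M) :=
  resolutionOfSequence
    (fun n => Nat.casesOn n (ModuleCat.of A P) fun k => Q.complex.X k)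
    (fun n => match n with
      | 0 => (IsProjective.iff_projective P).1 inferInstance
      | k + 1 => Q.projective k)
    (fun n => match n with
      | 0 => augmentation Q ≫ ModuleCat.ofHom (LinearMap.ker p).subtype
      | k + 1 => Q.complex.d (k + 1) k)
    (ModuleCat.ofHom p)
    (fun n => match n with
      | 0 => by
        -- Composing with the inclusion of the kernel into `P` does not change which elements die.
        intro x
        refine Iff.trans ?_ (augmentation_exact Q x)
        exact (Subtype.ext_iff (a1 := (augmentation Q).hom x) (a2 := 0)).symm
      | k + 1 => resolution_exact_succ Q k)
    (by
      intro x
      constructor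
      · intro hx
        obtain ⟨y, hy⟩ := augmentation_surjective Q ⟨x, hx⟩
        exact ⟨y, congrArg Subtype.val hy⟩
      · rintro ⟨y, rfl⟩
        exact ((augmentation Q).hom y).2)
    hp

theorem extendResolution_d_one_zero {P M : Type u} [AddCommGroup P] [Module A P] [AddCommGroup M]
    [Module A M] [Module.Projective A P] (p : P →ₗ[A] M) (hp : Function.Surjective p)
    (Q : ProjectiveResolution (ModuleCat.of A (LinearMap.ker p))) :
    (extendResolution p hp Q).complex.d 1 0 =
      augmentation Q ≫ ModuleCat.ofHom (LinearMap.ker p).subtype :=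
  resolutionOfSequence_d _ _ _ _ _ _ _ 0

theorem extendResolution_d_succ {P M : Type u} [AddCommGroup P] [Module A P] [AddCommGroup M]
    [Module A M] [Module.Projective A P] (p : P →ₗ[A] M) (hp : Function.Surjective p)
    (Q : ProjectiveResolution (ModuleCat.of A (LinearMap.ker p))) (n : ℕ) :
    (extendResolution p hp Q).complex.d (n + 1 + 1) (n + 1) = Q.complex.d (n + 1) n :=
  resolutionOfSequence_d _ _ _ _ _ _ _ (n + 1)

end Resolution

/-! ### Closure properties of super finitely presented modules -/

section SuperFinitelyPresented

variable {A : Type u} [Ring A]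

theorem SuperFinitelyPresented.exists_cover {M : Type u} [AddCommGroup M] [Module A M]
    (hM : SuperFinitelyPresented A M) :
    ∃ (P : Type u) (_ : AddCommGroup P) (_ : Module A P) (p : P →ₗ[A] M), Module.Finite A P ∧
      Module.Projective A P ∧ Function.Surjective p ∧
      SuperFinitelyPresented A (LinearMap.ker p) := by
  obtain ⟨Q, hQ⟩ := hM
  refine ⟨Q.complex.X 0, inferInstance, inferInstance, (augmentation Q).hom, hQ 0,
    (IsProjective.iff_projective _).2 (Q.projective 0), augmentation_surjective Q, ?_⟩
  -- The tail of `Q`, shifted by one, resolves the first syzygy; its augmentation is `d 1 0` with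
  -- codomain restricted to the kernel.
  refine ⟨resolutionOfSequence (fun n => Q.complex.X (n + 1)) (fun n => Q.projective (n + 1))
    (fun n => Q.complex.d (n + 1 + 1) (n + 1))
    (ModuleCat.ofHom ((Q.complex.d 1 0).hom.codRestrict (LinearMap.ker (augmentation Q).hom)
      fun x => (augmentation_exact Q).apply_apply_eq_zero x))
    (fun n => resolution_exact_succ Q (n + 1)) ?_ ?_, fun n => hQ (n + 1)⟩
  · intro x
    refine Iff.trans ?_ (resolution_exact_succ Q 0 x)
    exact Subtype.ext_iff
  · rintro ⟨y, hy⟩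
    obtain ⟨x, hx⟩ := (augmentation_exact Q y).1 hy
    exact ⟨x, Subtype.ext hx⟩

theorem SuperFinitelyPresented.of_cover {M P : Type u} [AddCommGroup M] [Module A M]
    [AddCommGroup P] [Module A P] [Module.Finite A P] [Module.Projective A P] (p : P →ₗ[A] M)
    (hp : Function.Surjective p) (hK : SuperFinitelyPresented A (LinearMap.ker p)) :
    SuperFinitelyPresented A M := by
  obtain ⟨Q, hQ⟩ := hK
  exact ⟨extendResolution p hp Q, fun n => match n with
    | 0 => ‹Module.Finite A P›
    | k + 1 => hQ k⟩

theorem SuperFinitelyPresented.of_equiv {M N : Type u} [AddCommGroup M] [Module A M]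
    [AddCommGroup N] [Module A N] (hM : SuperFinitelyPresented A M) (e : M ≃ₗ[A] N) :
    SuperFinitelyPresented A N := by
  obtain ⟨Q, hQ⟩ := hM
  refine ⟨resolutionOfSequence (fun n => Q.complex.X n) (fun n => Q.projective n)
    (fun n => Q.complex.d (n + 1) n) (augmentation Q ≫ ModuleCat.ofHom e.toLinearMap)
    (fun n => resolution_exact_succ Q n) ?_ ?_, hQ⟩
  · intro x
    refine Iff.trans ?_ (augmentation_exact Q x)
    exact e.map_eq_zero_iff
  · exact e.surjective.comp (augmentation_surjective Q)

/-- A class of modules in which every member has a finitely generated projective cover with kernel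
in the class consists of super finitely presented modules. -/
theorem SuperFinitelyPresented.of_class (X : ModuleCat.{u} A → Prop)
    (hX : ∀ M, X M → ∃ (P : ModuleCat.{u} A) (p : P →ₗ[A] M), Module.Finite A P ∧
      Module.Projective A P ∧ Function.Surjective p ∧ X (ModuleCat.of A (LinearMap.ker p)))
    (M : ModuleCat.{u} A) (hM : X M) : SuperFinitelyPresented A M := by
  choose P p hfin hproj hsurj hker using hX
  -- `K n` is the `n`-th syzygy. The resolution splices the sequences `0 → K (n + 1) → P → K n → 0`.
  let K : ℕ → {M : ModuleCat.{u} A // X M} := fun n =>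
    Nat.rec ⟨M, hM⟩ (fun _ N => ⟨ModuleCat.of A (LinearMap.ker (p N.1 N.2)), hker N.1 N.2⟩) n
  let Z : ∀ n, P (K n).1 (K n).2 →ₗ[A] (K n).1 := fun n => p (K n).1 (K n).2
  let ι : ∀ n, (K (n + 1)).1 →ₗ[A] P (K n).1 (K n).2 := fun n => (LinearMap.ker (Z n)).subtype
  have hι : ∀ n, Function.Injective (ι n) := fun n => Subtype.val_injective
  have hιZ : ∀ n, Function.Exact (ι n) (Z n) := fun n x =>
    ⟨fun hx => ⟨⟨x, hx⟩, rfl⟩, by rintro ⟨y, rfl⟩; exact y.2⟩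
  have hZ : ∀ n, Function.Surjective (Z n) := fun n => hsurj _ _
  refine ⟨resolutionOfSequence (fun n => P (K n).1 (K n).2)
    (fun n => (IsProjective.iff_projective _).1 (hproj _ _))
    (fun n => ModuleCat.ofHom (ι n ∘ₗ Z (n + 1))) (ModuleCat.ofHom (Z 0)) ?_ ?_ (hZ 0),
    fun n => hfin _ _⟩
  · intro n x
    constructor
    · intro hx
      have h1 : Z (n + 1) x = 0 := (map_eq_zero_iff (ι n) (hι n)).1 hx
      obtain ⟨y, hy⟩ := (hιZ (n + 1) x).1 h1
      obtain ⟨z, hz⟩ := hZ (n + 1 + 1) y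
      exact ⟨z, (congrArg (ι (n + 1)) hz).trans hy⟩
    · rintro ⟨z, rfl⟩
      exact (congrArg (ι n) ((hιZ (n + 1)).apply_apply_eq_zero _)).trans (map_zero _)
  · intro x
    constructor
    · intro hx
      obtain ⟨y, hy⟩ := (hιZ 0 x).1 hx
      obtain ⟨z, hz⟩ := hZ 1 y
      exact ⟨z, (congrArg (ι 0) hz).trans hy⟩
    · rintro ⟨z, rfl⟩
      exact (hιZ 0).apply_apply_eq_zero _

/-- Super finitely presented modules are closed under extensions. -/
theorem SuperFinitelyPresented.extension {M N L : Type u} [AddCommGroup M] [Module A M]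
    [AddCommGroup N] [Module A N] [AddCommGroup L] [Module A L] (f : M →ₗ[A] N) (g : N →ₗ[A] L)
    (hf : Function.Injective f) (hfg : Function.Exact f g) (hg : Function.Surjective g)
    (hM : SuperFinitelyPresented A M) (hL : SuperFinitelyPresented A L) :
    SuperFinitelyPresented A N := by
  -- The horseshoe construction, one step at a time: the cover `P × Q → N` built from covers `p` and
  -- `q` of the ends has as kernel an extension of `ker q` by `ker p`, which is again in the class.
  refine SuperFinitelyPresented.of_class (fun N => ∃ (M L : ModuleCat.{u} A) (f : M →ₗ[A] N)
    (g : N →ₗ[A] L), Function.Injective f ∧ Function.Exact f g ∧ Function.Surjective g ∧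
    SuperFinitelyPresented A M ∧ SuperFinitelyPresented A L) ?_ (ModuleCat.of A N)
    ⟨ModuleCat.of A M, ModuleCat.of A L, f, g, hf, hfg, hg, hM, hL⟩
  clear! M N L
  rintro N ⟨M, L, f, g, hf, hfg, hg, hM, hL⟩
  obtain ⟨P, _, _, p, _, _, hp, hpK⟩ := hM.exists_cover
  obtain ⟨Q, _, _, q, _, _, hq, hqK⟩ := hL.exists_cover
  obtain ⟨h, hh⟩ := Module.projective_lifting_property g q hg
  have hh' : ∀ y, g (h y) = q y := fun y => LinearMap.congr_fun hh y
  have hfg' : ∀ y, g (f y) = 0 := fun y => hfg.apply_apply_eq_zero y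
  refine ⟨ModuleCat.of A (P × Q), (f ∘ₗ p).coprod h, inferInstanceAs (Module.Finite A (P × Q)),
    inferInstanceAs (Module.Projective A (P × Q)), ?_,
    ModuleCat.of A (LinearMap.ker p), ModuleCat.of A (LinearMap.ker q),
    LinearMap.codRestrict _ (LinearMap.inl A P Q ∘ₗ (LinearMap.ker p).subtype) ?_,
    LinearMap.codRestrict _ (LinearMap.snd A P Q ∘ₗ (LinearMap.ker _).subtype) ?_, ?_, ?_, ?_,
    hpK, hqK⟩
  · intro n
    obtain ⟨y, hy⟩ := hq (g n)
    obtain ⟨m, hm⟩ := (hfg (n - h y)).1 (by rw [map_sub, hh', hy, sub_self])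
    obtain ⟨x, hx⟩ := hp m
    refine ⟨(x, y), ?_⟩
    change f (p x) + h y = n
    rw [hx, hm, sub_add_cancel]
  · rintro ⟨x, hx⟩
    change f (p x) + h 0 = 0
    rw [LinearMap.mem_ker.1 hx, map_zero, map_zero, add_zero]
  · rintro ⟨⟨x, y⟩, hxy⟩
    have hxy' : f (p x) + h y = 0 := hxy
    change q y = 0
    rw [← hh', ← zero_add (g (h y)), ← hfg' (p x), ← map_add, hxy', map_zero, hfg']
  · rintro ⟨x, hx⟩ ⟨y, hy⟩ hxy
    exact Subtype.ext (congrArg (fun z => z.1.1) hxy)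
  · rintro ⟨⟨x, y⟩, hxy⟩
    have hxy' : f (p x) + h y = 0 := hxy
    constructor
    · intro hy
      have hy' : y = 0 := congrArg Subtype.val hy
      subst hy'
      rw [map_zero, add_zero] at hxy'
      exact ⟨⟨x, hf (hxy'.trans (map_zero f).symm)⟩, rfl⟩
    · rintro ⟨z, hz⟩
      exact Subtype.ext (congrArg (fun z => z.1.2) hz).symm
  · rintro ⟨y, hy⟩
    obtain ⟨m, hm⟩ := (hfg (h y)).1 (by rw [hh']; exact hy)
    obtain ⟨x, hx⟩ := hp m
    refine ⟨⟨(-x, y), ?_⟩, rfl⟩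
    change f (p (-x)) + h y = 0
    rw [map_neg, map_neg, hx, hm, neg_add_cancel]

/-- Super finitely presented modules are closed under cokernels of injections. -/
theorem SuperFinitelyPresented.cokernel {M N L : Type u} [AddCommGroup M] [Module A M]
    [AddCommGroup N] [Module A N] [AddCommGroup L] [Module A L] (f : M →ₗ[A] N) (g : N →ₗ[A] L)
    (hf : Function.Injective f) (hfg : Function.Exact f g) (hg : Function.Surjective g)
    (hM : SuperFinitelyPresented A M) (hN : SuperFinitelyPresented A N) :
    SuperFinitelyPresented A L := by
  obtain ⟨P, _, _, p, _, _, hp, hpK⟩ := hN.exists_cover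
  -- Cover `L` through a cover of `N`; the new kernel is an extension of `ker g ≅ M` by `ker p`.
  refine .of_cover (g ∘ₗ p) (hg.comp hp) ?_
  have hker : LinearMap.range f = LinearMap.ker g := (LinearMap.exact_iff.1 hfg).symm
  have hK : SuperFinitelyPresented A (LinearMap.ker g) :=
    hM.of_equiv ((LinearEquiv.ofInjective f hf).trans (LinearEquiv.ofEq _ _ hker))
  refine .extension (Submodule.inclusion (p := LinearMap.ker p) (p' := LinearMap.ker (g ∘ₗ p)) ?_)
    (LinearMap.codRestrict (LinearMap.ker g) (p ∘ₗ (LinearMap.ker (g ∘ₗ p)).subtype) fun x => x.2)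
    (Submodule.inclusion_injective _) ?_ ?_ hpK hK
  · intro x hx
    change g (p x) = 0
    rw [LinearMap.mem_ker.1 hx, map_zero]
  · rintro ⟨x, hx⟩
    constructor
    · intro h
      exact ⟨⟨x, congrArg Subtype.val h⟩, rfl⟩
    · rintro ⟨z, hz⟩
      have hz' : (z : P) = x := congrArg Subtype.val hz
      exact Subtype.ext (by change p x = 0; rw [← hz']; exact z.2)
  · rintro ⟨y, hy⟩
    obtain ⟨x, rfl⟩ := hp y
    exact ⟨⟨x, hy⟩, rfl⟩

theorem SuperFinitelyPresented.of_subsingleton {M : Type u} [AddCommGroup M] [Module A M]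
    [Subsingleton M] : SuperFinitelyPresented A M := by
  refine SuperFinitelyPresented.of_class (fun N => Subsingleton N) ?_ (ModuleCat.of A M)
    (inferInstanceAs (Subsingleton M))
  intro N hN
  exact ⟨ModuleCat.of A (Fin 0 → A), 0, inferInstanceAs (Module.Finite A (Fin 0 → A)),
    inferInstanceAs (Module.Projective A (Fin 0 → A)), fun x => ⟨0, Subsingleton.elim _ _⟩,
    inferInstanceAs (Subsingleton (LinearMap.ker (0 : (Fin 0 → A) →ₗ[A] N)))⟩

theorem SuperFinitelyPresented.of_projective {P : Type u} [AddCommGroup P] [Module A P]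
    [Module.Finite A P] [Module.Projective A P] : SuperFinitelyPresented A P :=
  have : Subsingleton (LinearMap.ker (LinearMap.id : P →ₗ[A] P)) := by
    rw [LinearMap.ker_id]
    infer_instance
  .of_cover LinearMap.id Function.surjective_id .of_subsingleton

theorem SuperFinitelyPresented.pi {M : Type u} [AddCommGroup M] [Module A M]
    (hM : SuperFinitelyPresented A M) (n : ℕ) : SuperFinitelyPresented A (Fin n → M) := by
  induction n with
  | zero => exact .of_subsingleton
  | succ n ih =>
    refine SuperFinitelyPresented.of_equiv ?_ (Fin.consLinearEquiv A fun _ : Fin (n + 1) => M)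
    exact .extension (LinearMap.inl A M _) (LinearMap.snd A M _) LinearMap.inl_injective
      Function.Exact.inl_snd LinearMap.snd_surjective hM ih

/-- A super finitely presented module has a finitely generated free cover with super finitely
presented kernel. -/
theorem SuperFinitelyPresented.exists_free_cover {M : Type u} [AddCommGroup M] [Module A M]
    (hM : SuperFinitelyPresented A M) :
    ∃ (n : ℕ) (p : (Fin n → A) →ₗ[A] M), Function.Surjective p ∧
      SuperFinitelyPresented A (LinearMap.ker p) := by
  obtain ⟨P, _, _, p, _, _, hp, hpK⟩ := hM.exists_cover
  obtain ⟨n, f, hf⟩ := Module.Finite.exists_fin' A P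
  obtain ⟨s, hs⟩ := Module.projective_lifting_property f LinearMap.id hf
  have hs' : ∀ x, f (s x) = x := fun x => LinearMap.congr_fun hs x
  refine ⟨n, p ∘ₗ f, hp.comp hf, ?_⟩
  -- `id - s ∘ f` projects `Aⁿ` onto `ker f`, which is thus finitely generated projective; the
  -- kernel of `p ∘ f` is an extension of `ker p` by it.
  have : Module.Finite A (LinearMap.ker f) := by
    refine Module.Finite.of_surjective
      (LinearMap.codRestrict (LinearMap.ker f) (LinearMap.id - s ∘ₗ f) fun x => ?_) ?_
    · simp [hs']
    · rintro ⟨x, hx⟩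
      exact ⟨x, Subtype.ext (by simp [LinearMap.mem_ker.1 hx])⟩
  have : Module.Projective A (LinearMap.ker f) := by
    refine Module.Projective.of_split (LinearMap.ker f).subtype
      (LinearMap.codRestrict (LinearMap.ker f) (LinearMap.id - s ∘ₗ f) fun x => ?_) ?_
    · simp [hs']
    · ext x
      simp
  refine .extension (Submodule.inclusion (p := LinearMap.ker f) (p' := LinearMap.ker (p ∘ₗ f)) ?_)
    (LinearMap.codRestrict (LinearMap.ker p) (f ∘ₗ (LinearMap.ker (p ∘ₗ f)).subtype) fun x => x.2)
    (Submodule.inclusion_injective _) ?_ ?_ .of_projective hpK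
  · intro x hx
    change p (f x) = 0
    rw [LinearMap.mem_ker.1 hx, map_zero]
  · rintro ⟨x, hx⟩
    constructor
    · intro h
      exact ⟨⟨x, congrArg Subtype.val h⟩, rfl⟩
    · rintro ⟨z, hz⟩
      have hz' : (z : Fin n → A) = x := congrArg Subtype.val hz
      exact Subtype.ext (by change f x = 0; rw [← hz']; exact z.2)
  · rintro ⟨y, hy⟩
    obtain ⟨x, rfl⟩ := hf y
    exact ⟨⟨x, hy⟩, rfl⟩

end SuperFinitelyPresented

/-! ### Vanishing of Ext and dimension shifting -/

section Ext

variable {A : Type u} [Ring A]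

theorem shortExact_of_linearMap {M N L : Type u} [AddCommGroup M] [Module A M]
    [AddCommGroup N] [Module A N] [AddCommGroup L] [Module A L] {f : M →ₗ[A] N} {g : N →ₗ[A] L}
    (hf : Function.Injective f) (hfg : Function.Exact f g) (hg : Function.Surjective g) :
    (ShortComplex.mk (ModuleCat.ofHom f) (ModuleCat.ofHom g) (by
      ext x
      exact hfg.apply_apply_eq_zero x)).ShortExact where
  exact := (ShortComplex.ShortExact.moduleCat_exact_iff_function_exact _).2 hfg
  mono_f := (ModuleCat.mono_iff_injective _).2 hf
  epi_g := (ModuleCat.epi_iff_surjective _).2 hg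

/-- If `Ext^1(L, T) = 0`, maps to `T` extend along injections with cokernel `L`. -/
theorem exists_extension_of_ext_one {M N L T : Type u} [AddCommGroup M] [Module A M]
    [AddCommGroup N] [Module A N] [AddCommGroup L] [Module A L] [AddCommGroup T] [Module A T]
    {f : M →ₗ[A] N} {g : N →ₗ[A] L} (hf : Function.Injective f) (hfg : Function.Exact f g)
    (hg : Function.Surjective g) (hL : Subsingleton (ExtMod A 1 L T)) (h : M →ₗ[A] T) :
    ∃ h' : N →ₗ[A] T, h' ∘ₗ f = h := by
  obtain ⟨x, hx⟩ := Abelian.Ext.contravariant_sequence_exact₁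
    (shortExact_of_linearMap hf hfg hg) (ModuleCat.of A T) (Abelian.Ext.mk₀ (ModuleCat.ofHom h))
    (n₁ := 1) rfl (hL.elim _ _)
  obtain ⟨y, rfl⟩ := Abelian.Ext.addEquiv₀.symm.surjective x
  refine ⟨y.hom, ?_⟩
  have hx' : Abelian.Ext.mk₀ (ModuleCat.ofHom f ≫ y) = Abelian.Ext.mk₀ (ModuleCat.ofHom h) := by
    rw [← hx, ← Abelian.Ext.mk₀_comp_mk₀]
    rfl
  have := (Abelian.Ext.mk₀_bijective _ _).1 hx'
  exact congrArg ModuleCat.Hom.hom this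

variable {P X : Type u} [AddCommGroup P] [Module A P] [AddCommGroup X] [Module A X]
  [Module.Projective A P] {p : P →ₗ[A] X}

/-- Since `Ext^1(P, T) = 0`, every class comes from a map `ker p → T` by the connecting
homomorphism, and this kills maps that extend to `P`. -/
theorem ext_one_subsingleton (hp : Function.Surjective p) (T : Type u) [AddCommGroup T]
    [Module A T] (h : ∀ f : LinearMap.ker p →ₗ[A] T,
      ∃ f' : P →ₗ[A] T, f' ∘ₗ (LinearMap.ker p).subtype = f) :
    Subsingleton (ExtMod A 1 X T) := by
  have : Projective (ModuleCat.of A P) := (IsProjective.iff_projective P).1 inferInstance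
  have hS := shortExact_of_linearMap Subtype.val_injective (LinearMap.exact_subtype_ker_map p) hp
  refine subsingleton_of_forall_eq 0 fun e => ?_
  obtain ⟨y, rfl⟩ := Abelian.Ext.contravariant_sequence_exact₃ hS (ModuleCat.of A T) e
    (Abelian.Ext.eq_zero_of_projective (P := ModuleCat.of A P) _) (n₀ := 0) rfl
  obtain ⟨f, rfl⟩ := Abelian.Ext.addEquiv₀.symm.surjective y
  obtain ⟨f', hf'⟩ := h f.hom
  have hf : f = ModuleCat.ofHom (LinearMap.ker p).subtype ≫ ModuleCat.ofHom f' :=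
    ModuleCat.hom_ext hf'.symm
  rw [hf, Abelian.Ext.addEquiv₀_symm_apply, ← Abelian.Ext.mk₀_comp_mk₀]
  exact hS.extClass_comp_assoc _

/-- Dimension shifting for `Ext`. -/
theorem ext_ker_subsingleton_iff (hp : Function.Surjective p) (T : Type u) [AddCommGroup T]
    [Module A T] (n : ℕ) :
    Subsingleton (ExtMod A (n + 1) (LinearMap.ker p) T) ↔
      Subsingleton (ExtMod A (n + 2) X T) := by
  have : Projective (ModuleCat.of A P) := (IsProjective.iff_projective P).1 inferInstance
  have hS := shortExact_of_linearMap Subtype.val_injective (LinearMap.exact_subtype_ker_map p) hp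
  constructor
  · intro h
    refine subsingleton_of_forall_eq 0 fun e => ?_
    obtain ⟨y, rfl⟩ := Abelian.Ext.contravariant_sequence_exact₃ hS (ModuleCat.of A T) e
      (Abelian.Ext.eq_zero_of_projective (P := ModuleCat.of A P) _) (n₀ := n + 1) (by omega)
    rw [h.elim y 0]
    exact Abelian.Ext.comp_zero _ _ _ _ _
  · intro h
    refine subsingleton_of_forall_eq 0 fun e => ?_
    obtain ⟨y, rfl⟩ := Abelian.Ext.contravariant_sequence_exact₁ hS (ModuleCat.of A T) e
      (n₁ := n + 2) (by omega) (h.elim _ _)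
    rw [Abelian.Ext.eq_zero_of_projective (P := ModuleCat.of A P) y]
    exact Abelian.Ext.comp_zero _ _ _ _ _

theorem ext_subsingleton_of_equiv {M T T' : Type u} [AddCommGroup M] [Module A M]
    [AddCommGroup T] [Module A T] [AddCommGroup T'] [Module A T'] (e : T ≃ₗ[A] T') {n : ℕ}
    (h : Subsingleton (ExtMod A n M T)) : Subsingleton (ExtMod A n M T') :=
  have : Subsingleton ((Abelian.extFunctorObj (ModuleCat.of A M) n).obj (ModuleCat.of A T)) := h
  ((Abelian.extFunctorObj (ModuleCat.of A M) n).mapIso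
    e.toModuleIso).addCommGroupIsoToAddEquiv.symm.toEquiv.subsingleton

theorem WeakInjective.of_equiv {M N : Type u} [AddCommGroup M] [Module A M] [AddCommGroup N]
    [Module A N] (hM : WeakInjective A M) (e : M ≃ₗ[A] N) : WeakInjective A N :=
  fun F _ _ hF => ext_subsingleton_of_equiv e (hM F hF)

/-- Higher `Ext` from a super finitely presented module to a weak injective module vanishes. -/
theorem WeakInjective.ext_subsingleton {T : Type u} [AddCommGroup T] [Module A T]
    (hT : WeakInjective A T) (n : ℕ) : ∀ (F : Type u) [AddCommGroup F] [Module A F],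
      SuperFinitelyPresented A F → Subsingleton (ExtMod A (n + 1) F T) := by
  induction n with
  | zero => exact fun F _ _ hF => hT F hF
  | succ n ih =>
    intro F _ _ hF
    obtain ⟨P, _, _, p, _, _, hp, hK⟩ := hF.exists_cover
    exact (ext_ker_subsingleton_iff hp T n).1 (ih _ hK)

end Ext

/-! ### Right exactness of the tensor product over a noncommutative ring -/

section Tensor

variable {R : Type u} [Ring R]

namespace Tensor

variable {N N' N'' M M' : Type u} [AddCommGroup N] [Module Rᵐᵒᵖ N] [AddCommGroup N']
  [Module Rᵐᵒᵖ N'] [AddCommGroup N''] [Module Rᵐᵒᵖ N''] [AddCommGroup M] [Module R M]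
  [AddCommGroup M'] [Module R M']

/-- The additive map `x ↦ x ⊗ m`. -/
noncomputable def tmulHom (m : M) : N →+ Tensor R N M :=
  AddMonoidHom.mk' (fun x => tmul R x m) fun x y => add_tmul R x y m

theorem sub_tmul (x y : N) (m : M) : tmul R (x - y) m = tmul R x m - tmul R y m :=
  map_sub (tmulHom m) x y

theorem sum_tmul {ι : Type*} (s : Finset ι) (x : ι → N) (m : M) :
    tmul R (∑ i ∈ s, x i) m = ∑ i ∈ s, tmul R (x i) m :=
  map_sum (tmulHom m) x s

theorem mapLeft_comp_apply (f : N →ₗ[Rᵐᵒᵖ] N') (g : N' →ₗ[Rᵐᵒᵖ] N'') (t : Tensor R N M) :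
    mapLeft R M (g ∘ₗ f) t = mapLeft R M g (mapLeft R M f t) :=
  DFunLike.congr_fun (f := mapLeft R M (g ∘ₗ f)) (g := (mapLeft R M g).comp (mapLeft R M f))
    (addHom_ext fun _ _ => rfl) t

theorem mapLeft_id_apply (t : Tensor R N M) :
    mapLeft R M (LinearMap.id : N →ₗ[Rᵐᵒᵖ] N) t = t :=
  DFunLike.congr_fun (f := mapLeft R M LinearMap.id) (g := AddMonoidHom.id _) (addHom_ext fun _ _ => rfl) t

theorem mapLeft_zero_apply (t : Tensor R N M) :
    mapLeft R M (0 : N →ₗ[Rᵐᵒᵖ] N') t = 0 :=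
  DFunLike.congr_fun (g := (0 : Tensor R N M →+ Tensor R N' M))
    (addHom_ext fun _ m => map_zero (tmulHom (R := R) (N := N') m)) t

theorem mapLeft_surjective {f : N →ₗ[Rᵐᵒᵖ] N'} (hf : Function.Surjective f) :
    Function.Surjective (mapLeft R M f) := by
  intro t
  induction t using induction_on with
  | zero => exact ⟨0, map_zero _⟩
  | tmul x m =>
    obtain ⟨y, rfl⟩ := hf x
    exact ⟨tmul R y m, rfl⟩
  | add a b ha hb =>
    obtain ⟨a', rfl⟩ := ha
    obtain ⟨b', rfl⟩ := hb
    exact ⟨a' + b', map_add _ _ _⟩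

/-- The functor `- ⊗_R M` is right exact. -/
theorem mapLeft_exact {f : N →ₗ[Rᵐᵒᵖ] N'} {g : N' →ₗ[Rᵐᵒᵖ] N''} (hfg : Function.Exact f g)
    (hg : Function.Surjective g) : Function.Exact (mapLeft R M f) (mapLeft R M g) := by
  let q := QuotientAddGroup.mk' (mapLeft R M f).range
  have hq : ∀ t, q (mapLeft R M f t) = 0 := fun t =>
    (QuotientAddGroup.eq_zero_iff _).2 ⟨t, rfl⟩
  have key : ∀ (x y : N') (m : M), g x = g y → q (tmul R x m) = q (tmul R y m) := by
    intro x y m hxy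
    obtain ⟨z, hz⟩ := (hfg (x - y)).1 (by rw [map_sub, hxy, sub_self])
    rw [← sub_eq_zero, ← map_sub, ← sub_tmul, ← hz]
    exact hq (tmul R z m)
  -- A set-theoretic section suffices to invert the map from the cokernel to `N'' ⊗ M`: by `key`,
  -- its failure to be linear disappears modulo the range.
  let s := Function.surjInv hg
  have hs : ∀ y, g (s y) = y := Function.surjInv_eq hg
  let r : Tensor R N'' M →+ Tensor R N' M ⧸ (mapLeft R M f).range :=
    lift (AddMonoidHom.mk' (fun y => AddMonoidHom.mk' (fun m => q (tmul R (s y) m))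
        fun m n => by rw [tmul_add, map_add])
        fun y z => by
          ext m
          change q (tmul R (s (y + z)) m) = q (tmul R (s y) m) + q (tmul R (s z) m)
          rw [← map_add, ← add_tmul]
          exact key _ _ _ (by rw [map_add, hs, hs, hs]))
      fun y a m => by
        change q (tmul R (s (MulOpposite.op a • y)) m) = q (tmul R (s y) (a • m))
        rw [← smul_tmul]
        exact key _ _ _ (by rw [map_smul, hs, hs])
  have hr : r.comp (mapLeft R M g) = q := addHom_ext fun x m => key _ _ _ (hs (g x))
  intro t
  constructor
  · intro ht
    have : q t = 0 := by
      rw [← hr]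
      exact (congrArg r ht).trans (map_zero r)
    exact (QuotientAddGroup.eq_zero_iff _).1 this
  · rintro ⟨z, rfl⟩
    rw [← mapLeft_comp_apply, hfg.linearMap_comp_eq_zero, mapLeft_zero_apply]

/-- The additive map `N ⊗_R g : N ⊗_R M → N ⊗_R M'`. -/
noncomputable def mapRightHom (N : Type u) [AddCommGroup N] [Module Rᵐᵒᵖ N] (g : M →ₗ[R] M') :
    Tensor R N M →+ Tensor R N M' :=
  lift (AddMonoidHom.mk' (fun x => AddMonoidHom.mk'
      (fun m => tmul R x (g m)) fun m n => by rw [map_add, tmul_add])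
      fun x y => by ext m; exact add_tmul R x y (g m))
    fun x a m => by
      change tmul R (MulOpposite.op a • x) (g m) = tmul R x (g (a • m))
      rw [smul_tmul, map_smul]

section Bimodule

variable (S : Type u) [Ring S] [Module S N] [SMulCommClass S Rᵐᵒᵖ N]

/-- The `S`-linear map `N ⊗_R g : N ⊗_R M → N ⊗_R M'`. -/
noncomputable def mapRight (g : M →ₗ[R] M') : Tensor R N M →ₗ[S] Tensor R N M' where
  toAddHom := (mapRightHom N g).toAddHom
  map_smul' s t := by
    change mapRightHom N g (s • t) = s • mapRightHom N g t
    induction t using induction_on with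
    | zero => rw [smul_zero, map_zero, smul_zero]
    | tmul x m => rfl
    | add a b ha hb => rw [smul_add, map_add, map_add, smul_add, ha, hb]

theorem linearMap_ext {S : Type u} [Ring S] [Module S N] [SMulCommClass S Rᵐᵒᵖ N]
    {T : Type*} [AddCommGroup T] [Module S T]
    {f g : Tensor R N M →ₗ[S] T} (h : ∀ x m, f (tmul R x m) = g (tmul R x m)) : f = g :=
  LinearMap.toAddMonoidHom_injective (addHom_ext h)

/-- The `S`-linear equivalence `N ⊗_R M ≃ N ⊗_R M'` induced by `M ≃ M'`. -/
noncomputable def congrRight (e : M ≃ₗ[R] M') : Tensor R N M ≃ₗ[S] Tensor R N M' :=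
  LinearEquiv.ofLinearMap (mapRight S e.toLinearMap) (mapRight S e.symm.toLinearMap)
    (linearMap_ext fun x m => congrArg (tmul R x) (e.apply_symm_apply m))
    (linearMap_ext fun x m => congrArg (tmul R x) (e.symm_apply_apply m))

end Bimodule

end Tensor

end Tensor

/-! ### Vanishing of Tor and dimension shifting -/

section Tor

variable {R : Type u} [Ring R] {D F : Type u} [AddCommGroup D] [Module Rᵐᵒᵖ D]
  [AddCommGroup F] [Module R F]

/-- Tor is the homology of the tensored resolution. The differentials enter as `f` and `g` with
equations so that those of a spliced resolution can be given in explicit form. -/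
theorem tor_succ_subsingleton_iff (Q : ProjectiveResolution (ModuleCat.of Rᵐᵒᵖ D)) (n : ℕ)
    {f : Q.complex.X (n + 1 + 1) ⟶ Q.complex.X (n + 1)} {g : Q.complex.X (n + 1) ⟶ Q.complex.X n}
    (hf : Q.complex.d (n + 1 + 1) (n + 1) = f) (hg : Q.complex.d (n + 1) n = g) :
    Subsingleton (Tor R (n + 1) D F) ↔
      Function.Exact (Tensor.mapLeft R F f.hom) (Tensor.mapLeft R F g.hom) := by
  subst hf hg
  let K := ((tensorFunctor R F).mapHomologicalComplex _).obj Q.complex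
  have h1 : Subsingleton (Tor R (n + 1) D F) ↔ Limits.IsZero (Tor R (n + 1) D F) :=
    ⟨fun h => AddCommGrpCat.isZero_of_subsingleton _, fun h =>
      AddCommGrpCat.subsingleton_of_isZero h⟩
  rw [h1, Tor, (Q.isoLeftDerivedObj (tensorFunctor R F) (n + 1)).isZero_iff]
  change Limits.IsZero (K.homology (n + 1)) ↔ _
  rw [← HomologicalComplex.exactAt_iff_isZero_homology,
    HomologicalComplex.exactAt_iff' _ (n + 1 + 1) (n + 1) n (by simp) (by simp),
    ShortComplex.ab_exact_iff_function_exact]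
  rfl

variable {P : Type u} [AddCommGroup P] [Module Rᵐᵒᵖ P] [Module.Projective Rᵐᵒᵖ P]
  {p : P →ₗ[Rᵐᵒᵖ] D}

/-- Splice a resolution `Q` of `ker p` onto `P`. By right exactness `Q₀ ⊗ F` modulo the image of `Q₁
⊗ F` is `ker p ⊗ F`, so exactness at `Q₀ ⊗ F` says that `ker p ⊗ F → P ⊗ F` is injective. -/
theorem tor_one_subsingleton_iff (hp : Function.Surjective p) :
    Subsingleton (Tor R 1 D F) ↔
      Function.Injective (Tensor.mapLeft R F (LinearMap.ker p).subtype) := by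
  let Q := ProjectiveResolution.of (ModuleCat.of Rᵐᵒᵖ (LinearMap.ker p))
  refine (tor_succ_subsingleton_iff (extendResolution p hp Q) 0
    (extendResolution_d_succ p hp Q 0) (extendResolution_d_one_zero p hp Q)).trans ?_
  have hex := Tensor.mapLeft_exact (M := F) (augmentation_exact Q) (augmentation_surjective Q)
  have hsurj := Tensor.mapLeft_surjective (M := F) (augmentation_surjective Q)
  change Function.Exact (Tensor.mapLeft R F (Q.complex.d 1 0).hom)
    (Tensor.mapLeft R F ((LinearMap.ker p).subtype ∘ₗ (augmentation Q).hom)) ↔ _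
  rw [injective_iff_map_eq_zero]
  constructor
  · intro h t ht
    obtain ⟨s, rfl⟩ := hsurj t
    exact (hex s).2 ((h s).1 ((Tensor.mapLeft_comp_apply _ _ _).trans ht))
  · intro h s
    rw [Tensor.mapLeft_comp_apply, ← hex s]
    exact ⟨h _, fun h0 => (congrArg _ h0).trans (map_zero _)⟩

/-- Dimension shifting for `Tor`. -/
theorem tor_ker_subsingleton_iff (hp : Function.Surjective p) (n : ℕ) :
    Subsingleton (Tor R (n + 1) (LinearMap.ker p) F) ↔ Subsingleton (Tor R (n + 2) D F) := by
  let Q := ProjectiveResolution.of (ModuleCat.of Rᵐᵒᵖ (LinearMap.ker p))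
  exact (tor_succ_subsingleton_iff Q n rfl rfl).trans
    (tor_succ_subsingleton_iff (extendResolution p hp Q) (n + 1)
      (extendResolution_d_succ p hp Q (n + 1)) (extendResolution_d_succ p hp Q n)).symm

/-- If `Tor_1(L, F) = 0`, then `- ⊗ F` preserves injections with cokernel `L`. -/
theorem mapLeft_injective_of_tor_one {M N L : Type u} [AddCommGroup M] [Module Rᵐᵒᵖ M]
    [AddCommGroup N] [Module Rᵐᵒᵖ N] [AddCommGroup L] [Module Rᵐᵒᵖ L] {f : M →ₗ[Rᵐᵒᵖ] N}
    {g : N →ₗ[Rᵐᵒᵖ] L} (hf : Function.Injective f) (hfg : Function.Exact f g)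
    (hg : Function.Surjective g) (hL : Subsingleton (Tor R 1 L F)) :
    Function.Injective (Tensor.mapLeft R F f) := by
  obtain ⟨P, _, _, _, p, hp⟩ : ∃ (P : Type u) (_ : AddCommGroup P) (_ : Module Rᵐᵒᵖ P)
      (_ : Module.Projective Rᵐᵒᵖ P) (p : P →ₗ[Rᵐᵒᵖ] L), Function.Surjective p :=
    ⟨L →₀ Rᵐᵒᵖ, inferInstance, inferInstance, inferInstance, _,
      Finsupp.linearCombination_id_surjective Rᵐᵒᵖ L⟩
  have hinj := (tor_one_subsingleton_iff hp).1 hL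
  obtain ⟨h, hh⟩ := Module.projective_lifting_property g p hg
  have hh' : ∀ y, g (h y) = p y := fun y => LinearMap.congr_fun hh y
  let e := LinearEquiv.ofInjective f hf
  let k : LinearMap.ker p →ₗ[Rᵐᵒᵖ] M := e.symm.toLinearMap ∘ₗ
    LinearMap.codRestrict (LinearMap.range f) (h ∘ₗ (LinearMap.ker p).subtype)
      fun x => (hfg _).1 ((hh' x).trans x.2)
  have hk : ∀ x, f (k x) = h x := fun x => congrArg Subtype.val (e.apply_symm_apply _)
  -- With `h : P → N` lifting `p`, the sequence `ker p → M × P → N → 0` is exact. An `a` killed in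
  -- `N ⊗ F` gives `(a, 0)` coming from some `z` in `ker p ⊗ F`; its `P`-component forces `z = 0`,
  -- and then its `M`-component gives `a = 0`.
  let φ : M × P →ₗ[Rᵐᵒᵖ] N := f.coprod (-h)
  have hφ : ∀ m x, φ (m, x) = f m - h x := fun m x => (sub_eq_add_neg _ _).symm
  have hφs : Function.Surjective φ := by
    intro n
    obtain ⟨x, hx⟩ := hp (g n)
    obtain ⟨m, hm⟩ := (hfg (n - h x)).1 (by rw [map_sub, hh', hx, sub_self])
    exact ⟨(m, -x), by rw [hφ, hm, map_neg, sub_neg_eq_add, sub_add_cancel]⟩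
  have hφe : Function.Exact (k.prod (LinearMap.ker p).subtype) φ := by
    rintro ⟨m, x⟩
    rw [hφ]
    constructor
    · intro hx
      have hx' : p x = 0 := by
        rw [← hh', ← sub_eq_zero.1 hx]
        exact hfg.apply_apply_eq_zero m
      refine ⟨⟨x, hx'⟩, Prod.ext (hf ?_) rfl⟩
      exact (hk _).trans (sub_eq_zero.1 hx).symm
    · rintro ⟨y, hy⟩
      have h1 : k y = m := congrArg Prod.fst hy
      have h2 : (y : P) = x := congrArg Prod.snd hy
      rw [← h1, ← h2, hk, sub_self]
  have hex := Tensor.mapLeft_exact (M := F) (f := k.prod (LinearMap.ker p).subtype) hφe hφs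
  rw [injective_iff_map_eq_zero]
  intro a ha
  have h1 : φ ∘ₗ LinearMap.inl Rᵐᵒᵖ M P = f := by
    ext m
    simp [φ]
  obtain ⟨z, hz⟩ := (hex (Tensor.mapLeft R F (LinearMap.inl Rᵐᵒᵖ M P) a)).1 (by
    rw [← Tensor.mapLeft_comp_apply, h1, ha])
  have h2 : Tensor.mapLeft R F (LinearMap.ker p).subtype z = 0 := by
    have := congrArg (Tensor.mapLeft R F (LinearMap.snd Rᵐᵒᵖ M P)) hz
    rwa [← Tensor.mapLeft_comp_apply, ← Tensor.mapLeft_comp_apply, LinearMap.snd_prod,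
      LinearMap.snd_comp_inl, Tensor.mapLeft_zero_apply] at this
  rw [hinj (h2.trans (map_zero _).symm), map_zero] at hz
  have := congrArg (Tensor.mapLeft R F (LinearMap.fst Rᵐᵒᵖ M P)) hz
  rw [map_zero, ← Tensor.mapLeft_comp_apply, LinearMap.fst_comp_inl,
    Tensor.mapLeft_id_apply] at this
  exact this.symm

theorem tor_subsingleton_of_equiv {F' : Type u} [AddCommGroup F'] [Module R F'] (e : F ≃ₗ[R] F')
    {n : ℕ} (h : Subsingleton (Tor R n D F)) : Subsingleton (Tor R n D F') := by
  let map {M M' : Type u} [AddCommGroup M] [Module R M] [AddCommGroup M'] [Module R M']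
      (g : M →ₗ[R] M') : tensorFunctor R M ⟶ tensorFunctor R M' :=
    { app := fun N => AddCommGrpCat.ofHom (Tensor.mapRightHom N g)
      naturality := fun N N' f => by
        ext1
        exact Tensor.addHom_ext fun _ _ => rfl }
  have hmap : map e.symm.toLinearMap ≫ map e.toLinearMap = 𝟙 _ := by
    ext N : 2
    refine AddCommGrpCat.hom_ext ?_
    exact Tensor.addHom_ext (f := (Tensor.mapRightHom N e.toLinearMap).comp
      (Tensor.mapRightHom N e.symm.toLinearMap)) (g := AddMonoidHom.id _)
      fun x m => congrArg (Tensor.tmul R x) (e.apply_symm_apply m)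
  let a : Tor R n D F' ⟶ Tor R n D F := (NatTrans.leftDerived (map e.symm.toLinearMap) n).app _
  let b : Tor R n D F ⟶ Tor R n D F' := (NatTrans.leftDerived (map e.toLinearMap) n).app _
  -- One composite is enough: it makes the Tor of `F'` a retract of the zero Tor of `F`.
  have hab : a ≫ b = 𝟙 _ := by
    have := congrArg (fun α => (NatTrans.leftDerived α n).app (ModuleCat.of Rᵐᵒᵖ D)) hmap
    simp only [NatTrans.leftDerived_comp, NatTrans.leftDerived_id] at this
    exact this
  refine subsingleton_of_forall_eq 0 fun t => ?_
  have ht : b.hom (a.hom t) = t := congrArg (fun α => α.hom t) hab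
  rw [← ht, h.elim (a.hom t) 0, map_zero]

theorem WeakFlat.of_equiv {F' : Type u} [AddCommGroup F'] [Module R F'] (hF : WeakFlat R F)
    (e : F ≃ₗ[R] F') : WeakFlat R F' :=
  fun D _ _ hD => tor_subsingleton_of_equiv e (hF D hD)

/-- Higher `Tor` of a super finitely presented module and a weak flat module vanishes. -/
theorem WeakFlat.tor_subsingleton (hF : WeakFlat R F) (n : ℕ) :
    ∀ (D : Type u) [AddCommGroup D] [Module Rᵐᵒᵖ D],
      SuperFinitelyPresented Rᵐᵒᵖ D → Subsingleton (Tor R (n + 1) D F) := by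
  induction n with
  | zero => exact fun D _ _ hD => hF D hD
  | succ n ih =>
    intro D _ _ hD
    obtain ⟨P, _, _, p, _, _, hp, hK⟩ := hD.exists_cover
    exact (tor_ker_subsingleton_iff hp n).1 (ih _ hK)

end Tor

/-! ### Duality with respect to `C` -/

section Dual

/-- Precomposition with `f`, as a map `Hom_A(Y, C) → Hom_A(X, C)` that is linear over the ring `B`
acting on `C`. -/
def dualMap {A : Type*} (B : Type*) {C X Y : Type*} [Ring A] [Ring B] [AddCommGroup C]
    [AddCommGroup X] [AddCommGroup Y] [Module A C] [Module B C] [SMulCommClass A B C] [Module A X]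
    [Module A Y] (f : X →ₗ[A] Y) : (Y →ₗ[A] C) →ₗ[B] (X →ₗ[A] C) where
  toFun φ := φ ∘ₗ f
  map_add' _ _ := rfl
  map_smul' _ _ := rfl

theorem exists_factor_of_exact {A X Y Z T : Type*} [Ring A] [AddCommGroup X] [AddCommGroup Y]
    [AddCommGroup Z] [AddCommGroup T] [Module A X] [Module A Y] [Module A Z] [Module A T]
    {f : X →ₗ[A] Y} {g : Y →ₗ[A] Z} (hfg : Function.Exact f g) (hg : Function.Surjective g)
    (h : Y →ₗ[A] T) (hh : h ∘ₗ f = 0) : ∃ h' : Z →ₗ[A] T, h' ∘ₗ g = h := by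
  refine ⟨(LinearMap.ker g).liftQ h (fun y hy => ?_) ∘ₗ
    (g.quotKerEquivOfSurjective hg).symm.toLinearMap, ?_⟩
  · obtain ⟨x, rfl⟩ := (hfg y).1 hy
    exact LinearMap.congr_fun hh x
  · ext y
    have : (g.quotKerEquivOfSurjective hg).symm (g y) = Submodule.Quotient.mk y := by
      rw [LinearEquiv.symm_apply_eq]
      rfl
    simp [this]

variable {A B C : Type u} [Ring A] [Ring B] [AddCommGroup C] [Module A C] [Module B C]
  [SMulCommClass A B C]

section Exact

variable {X Y Z : Type u} [AddCommGroup X] [AddCommGroup Y] [AddCommGroup Z] [Module A X]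
  [Module A Y] [Module A Z] {f : X →ₗ[A] Y} {g : Y →ₗ[A] Z}

theorem dualMap_injective (hg : Function.Surjective g) :
    Function.Injective (dualMap B (C := C) g) :=
  fun _ _ h => LinearMap.cancel_right hg |>.1 h

theorem dualMap_exact (hfg : Function.Exact f g) (hg : Function.Surjective g) :
    Function.Exact (dualMap B (C := C) g) (dualMap B (C := C) f) := by
  intro φ
  constructor
  · intro h
    exact exists_factor_of_exact hfg hg φ h
  · rintro ⟨ψ, rfl⟩
    change (ψ ∘ₗ g) ∘ₗ f = 0
    rw [LinearMap.comp_assoc, hfg.linearMap_comp_eq_zero, LinearMap.comp_zero]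

theorem dualMap_surjective (hf : Function.Injective f) (hfg : Function.Exact f g)
    (hg : Function.Surjective g) (hZ : Subsingleton (ExtMod A 1 Z C)) :
    Function.Surjective (dualMap B (C := C) f) :=
  exists_extension_of_ext_one hf hfg hg hZ

end Exact

/-- The map `C → Hom_A(Aⁿ, C)` sending `c` to `v ↦ v i • c`. -/
def coordDual (A B C : Type u) [Ring A] [Ring B] [AddCommGroup C] [Module A C] [Module B C]
    [SMulCommClass A B C] {n : ℕ} (i : Fin n) : C →ₗ[B] ((Fin n → A) →ₗ[A] C) where
  toFun c := LinearMap.toSpanSingleton A C c ∘ₗ LinearMap.proj i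
  map_add' c d := LinearMap.ext fun v => smul_add (v i) c d
  map_smul' b c := LinearMap.ext fun v => smul_comm (v i) b c

theorem sum_smul_apply_single {T : Type*} [AddCommGroup T] [Module A T] {n : ℕ}
    (φ : (Fin n → A) →ₗ[A] T) (v : Fin n → A) :
    ∑ i, v i • φ (Pi.single i 1) = φ v := by
  conv_rhs => rw [← Finset.univ_sum_single v, map_sum]
  refine Finset.sum_congr rfl fun i _ => ?_
  rw [← map_smul, ← Pi.single_smul, smul_eq_mul, mul_one]

theorem sum_coordDual {n : ℕ} (φ : (Fin n → A) →ₗ[A] C) :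
    ∑ i, coordDual A B C i (φ (Pi.single i 1)) = φ := by
  refine LinearMap.ext fun v => ?_
  rw [LinearMap.sum_apply]
  exact sum_smul_apply_single φ v

/-- The modules `X` over `A` to which the duality `Hom_A(-, C)` applies: `X` and its dual are super
finitely presented, and `X` has no higher extensions by `C`. -/
structure Dualizable (A B C X : Type u) [Ring A] [Ring B] [AddCommGroup C] [Module A C]
    [Module B C] [SMulCommClass A B C] [AddCommGroup X] [Module A X] : Prop where
  superFinitelyPresented : SuperFinitelyPresented A X
  ext_eq_zero : ∀ n : ℕ, Subsingleton (ExtMod A (n + 1) X C)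
  dual : SuperFinitelyPresented B (X →ₗ[A] C)

/-- Ext vanishing passes to the kernel by dimension shifting. As `Ext^1(X, C) = 0`, the dual of the
kernel is the cokernel of `X* → Hom(Aⁿ, C) ≅ Cⁿ`, an injection of super finitely presented modules.
-/
theorem Dualizable.exists_free_cover (hC : SuperFinitelyPresented B C) {X : Type u}
    [AddCommGroup X] [Module A X] (hX : Dualizable A B C X) :
    ∃ (n : ℕ) (p : (Fin n → A) →ₗ[A] X), Function.Surjective p ∧
      Dualizable A B C (LinearMap.ker p) := by
  obtain ⟨n, p, hp, hK⟩ := hX.superFinitelyPresented.exists_free_cover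
  refine ⟨n, p, hp, hK, fun i => (ext_ker_subsingleton_iff hp C i).2 (hX.ext_eq_zero (i + 1)),
    .cokernel (dualMap B p) (dualMap B (LinearMap.ker p).subtype) (dualMap_injective hp)
      (dualMap_exact (LinearMap.exact_subtype_ker_map p) hp)
      (dualMap_surjective Subtype.val_injective (LinearMap.exact_subtype_ker_map p) hp
        (hX.ext_eq_zero 0)) hX.dual ?_⟩
  exact (hC.pi n).of_equiv ((Pi.basisFun A (Fin n)).constr B)

/-- The homothety map `b ↦ (x ↦ b x)` from `B` to `Hom_A(C, C)`. -/
def homothety (A B C : Type u) [Ring A] [Ring B] [AddCommGroup C] [Module A C] [Module B C]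
    [SMulCommClass A B C] : B →ₗ[B] (C →ₗ[A] C) :=
  LinearMap.toSpanSingleton B (C →ₗ[A] C) LinearMap.id

/-- The homothety makes the dual of `C` free of rank one over `B`. -/
theorem Dualizable.self (hC : SuperFinitelyPresented A C)
    (hext : ∀ i : ℕ, 1 ≤ i → Subsingleton (ExtMod A i C C))
    (hbij : Function.Bijective (homothety A B C)) : Dualizable A B C C where
  superFinitelyPresented := hC
  ext_eq_zero n := hext (n + 1) (Nat.le_add_left 1 n)
  dual := SuperFinitelyPresented.of_projective.of_equiv (LinearEquiv.ofBijective _ hbij)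

end Dual

/-! ### Tensor evaluation: weak flat modules are in the Auslander class -/

section TensorEvaluation

variable {R S C F : Type u} [Ring R] [Ring S] [AddCommGroup C] [Module S C] [Module Rᵐᵒᵖ C]
  [SMulCommClass S Rᵐᵒᵖ C] [AddCommGroup F] [Module R F]

section

variable {X Y : Type u} [AddCommGroup X] [Module S X] [AddCommGroup Y] [Module S Y]

/-- The tensor evaluation `Hom_S(X, C) ⊗_R F → Hom_S(X, C ⊗_R F)`, `φ ⊗ m ↦ (x ↦ φ x ⊗ m)`. -/
noncomputable def tensorEvaluation (R S C F X : Type u) [Ring R] [Ring S] [AddCommGroup C]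
    [Module S C] [Module Rᵐᵒᵖ C] [SMulCommClass S Rᵐᵒᵖ C] [AddCommGroup F] [Module R F]
    [AddCommGroup X] [Module S X] : Tensor R (X →ₗ[S] C) F →+ (X →ₗ[S] Tensor R C F) :=
  Tensor.lift (AddMonoidHom.mk' (fun φ => AddMonoidHom.mk' (fun m =>
        ({ toFun := fun x => Tensor.tmul R (φ x) m
           map_add' := fun x y => by rw [map_add, Tensor.add_tmul]
           map_smul' := fun s x => by rw [map_smul]; rfl } : X →ₗ[S] Tensor R C F))
        fun m m' => LinearMap.ext fun x => Tensor.tmul_add R (φ x) m m')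
      fun φ ψ => by
        ext m x
        exact Tensor.add_tmul R (φ x) (ψ x) m)
    fun φ r m => LinearMap.ext fun x => Tensor.smul_tmul R r (φ x) m

theorem tensorEvaluation_dualMap (f : X →ₗ[S] Y) (t : Tensor R (Y →ₗ[S] C) F) :
    tensorEvaluation R S C F X (Tensor.mapLeft R F (dualMap Rᵐᵒᵖ f) t) =
      tensorEvaluation R S C F Y t ∘ₗ f := by
  induction t using Tensor.induction_on with
  | zero => simp
  | tmul φ m => rfl
  | add a b ha hb => rw [map_add, map_add, map_add, ha, hb, LinearMap.add_comp]

theorem tensorEvaluation_coordDual {n : ℕ} (i : Fin n) (t : Tensor R C F) (v : Fin n → S) :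
    tensorEvaluation R S C F (Fin n → S) (Tensor.mapLeft R F (coordDual S Rᵐᵒᵖ C i) t) v =
      v i • t := by
  induction t using Tensor.induction_on with
  | zero => simp
  | tmul c m => rfl
  | add a b ha hb => rw [map_add, map_add, LinearMap.add_apply, ha, hb, smul_add]

theorem tensorEvaluation_free_bijective (n : ℕ) :
    Function.Bijective (tensorEvaluation R S C F (Fin n → S)) := by
  let r : ((Fin n → S) →ₗ[S] Tensor R C F) → Tensor R ((Fin n → S) →ₗ[S] C) F := fun h =>
    ∑ i, Tensor.mapLeft R F (coordDual S Rᵐᵒᵖ C i) (h (Pi.single i 1))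
  refine Function.bijective_iff_has_inverse.2 ⟨r, fun t => ?_, fun h => ?_⟩
  · induction t using Tensor.induction_on with
    | zero => simp [r]
    | tmul φ m =>
      change ∑ i, Tensor.tmul R (coordDual S Rᵐᵒᵖ C i (φ (Pi.single i 1))) m = _
      rw [← Tensor.sum_tmul, sum_coordDual]
    | add a b ha hb =>
      simp only [r, map_add, LinearMap.add_apply, Finset.sum_add_distrib] at ha hb ⊢
      rw [ha, hb]
  · refine LinearMap.ext fun v => ?_
    rw [map_sum, LinearMap.sum_apply]
    simp only [tensorEvaluation_coordDual]
    exact sum_smul_apply_single h v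

/-- `Tor_1(K*, F) = 0` makes `X* ⊗ F → (Sⁿ)* ⊗ F` injective, and evaluation is bijective on the free
module. -/
theorem tensorEvaluation_injective (hC : SuperFinitelyPresented Rᵐᵒᵖ C) (hF : WeakFlat R F)
    (hX : Dualizable S Rᵐᵒᵖ C X) : Function.Injective (tensorEvaluation R S C F X) := by
  obtain ⟨n, p, hp, hK⟩ := hX.exists_free_cover hC
  have hex := LinearMap.exact_subtype_ker_map p
  have hinj := mapLeft_injective_of_tor_one (F := F) (dualMap_injective (B := Rᵐᵒᵖ) (C := C) hp)
    (dualMap_exact hex hp) (dualMap_surjective Subtype.val_injective hex hp (hX.ext_eq_zero 0))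
    (hF _ hK.dual)
  rw [injective_iff_map_eq_zero]
  intro t ht
  refine hinj ((tensorEvaluation_free_bijective n).1 ?_)
  rw [tensorEvaluation_dualMap, ht, map_zero, map_zero, LinearMap.zero_comp]

/-- For surjectivity, represent `h ∘ p` by `t` in `(Sⁿ)* ⊗ F`. Its restriction to `K* ⊗ F` evaluates
to zero, hence vanishes by injectivity for the dualizable `K`, so `t` comes from `X* ⊗ F`. -/
theorem tensorEvaluation_bijective (hC : SuperFinitelyPresented Rᵐᵒᵖ C) (hF : WeakFlat R F)
    (hX : Dualizable S Rᵐᵒᵖ C X) : Function.Bijective (tensorEvaluation R S C F X) := by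
  refine ⟨tensorEvaluation_injective hC hF hX, fun h => ?_⟩
  obtain ⟨n, p, hp, hK⟩ := hX.exists_free_cover hC
  have hex := LinearMap.exact_subtype_ker_map p
  obtain ⟨t, ht⟩ := (tensorEvaluation_free_bijective n).2 (h ∘ₗ p)
  have hexT := Tensor.mapLeft_exact (M := F) (dualMap_exact (B := Rᵐᵒᵖ) (C := C) hex hp)
    (dualMap_surjective Subtype.val_injective hex hp (hX.ext_eq_zero 0))
  obtain ⟨s, rfl⟩ := (hexT t).1 (tensorEvaluation_injective hC hF hK (by
    rw [tensorEvaluation_dualMap, ht, LinearMap.comp_assoc, hex.linearMap_comp_eq_zero,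
      LinearMap.comp_zero, map_zero]))
  rw [tensorEvaluation_dualMap] at ht
  exact ⟨s, (LinearMap.cancel_right hp).1 ht⟩

end

/-- In degree one, a map `K → C ⊗ F` is the evaluation of an element of `K* ⊗ F`; lifting that
element to `(Sⁿ)* ⊗ F` extends the map. Since `K` is dualizable, dimension shifting does the rest.
-/
theorem ext_tensor_subsingleton (hC : SuperFinitelyPresented Rᵐᵒᵖ C) (hF : WeakFlat R F) (i : ℕ) :
    ∀ (X : Type u) [AddCommGroup X] [Module S X], Dualizable S Rᵐᵒᵖ C X →
      Subsingleton (ExtMod S (i + 1) X (Tensor R C F)) := by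
  induction i with
  | zero =>
    intro X _ _ hX
    obtain ⟨n, p, hp, hK⟩ := hX.exists_free_cover hC
    have hex := LinearMap.exact_subtype_ker_map p
    refine ext_one_subsingleton hp _ fun f => ?_
    obtain ⟨t, rfl⟩ := (tensorEvaluation_bijective hC hF hK).2 f
    obtain ⟨s, rfl⟩ := Tensor.mapLeft_surjective (M := F)
      (dualMap_surjective (B := Rᵐᵒᵖ) Subtype.val_injective hex hp (hX.ext_eq_zero 0)) t
    exact ⟨_, (tensorEvaluation_dualMap _ s).symm⟩
  | succ i ih =>
    intro X _ _ hX
    obtain ⟨n, p, hp, hK⟩ := hX.exists_free_cover hC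
    exact (ext_ker_subsingleton_iff hp _ i).1 (ih _ hK)

/-- The unit is `m ↦ id ⊗ m` into `Hom_S(C, C) ⊗ F`, bijective by the homothety isomorphism,
followed by tensor evaluation at `X = C`. -/
theorem unitMap_bijective (hC : SuperFinitelyPresented Rᵐᵒᵖ C) (hF : WeakFlat R F)
    (hbij : Function.Bijective (homothety S Rᵐᵒᵖ C)) (hX : Dualizable S Rᵐᵒᵖ C C) :
    Function.Bijective (unitMap R S C F) := by
  let e := (LinearEquiv.ofBijective _ hbij).symm
  have he : ∀ φ, e φ • (LinearMap.id : C →ₗ[S] C) = φ :=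
    (LinearEquiv.ofBijective _ hbij).apply_symm_apply
  have he1 : e LinearMap.id = 1 := by
    rw [LinearEquiv.symm_apply_eq]
    exact (one_smul Rᵐᵒᵖ (LinearMap.id : C →ₗ[S] C)).symm
  let σ : Tensor R (C →ₗ[S] C) F →+ F :=
    Tensor.lift (AddMonoidHom.mk' (fun φ => AddMonoidHom.mk' (fun m => (e φ).unop • m)
        fun m m' => smul_add _ m m')
        fun φ ψ => by
          ext m
          change (e (φ + ψ)).unop • m = (e φ).unop • m + (e ψ).unop • m
          rw [map_add, MulOpposite.unop_add, add_smul])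
      fun φ r m => by
        change (e (MulOpposite.op r • φ)).unop • m = (e φ).unop • r • m
        rw [map_smul, smul_eq_mul, MulOpposite.unop_mul, mul_smul, MulOpposite.unop_op]
  have hτ : Function.Bijective fun m : F => Tensor.tmul R (LinearMap.id : C →ₗ[S] C) m := by
    refine Function.bijective_iff_has_inverse.2 ⟨σ, fun m => ?_, fun t => ?_⟩
    · change (e LinearMap.id).unop • m = m
      rw [he1, MulOpposite.unop_one, one_smul]
    · induction t using Tensor.induction_on with
      | zero => exact (congrArg _ (map_zero σ)).trans (by
          simpa using Tensor.tmul_add R (LinearMap.id : C →ₗ[S] C) (0 : F) 0)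
      | tmul φ m =>
        change Tensor.tmul R LinearMap.id ((e φ).unop • m) = Tensor.tmul R φ m
        rw [← Tensor.smul_tmul, MulOpposite.op_unop, he]
      | add a b ha hb =>
        change Tensor.tmul R LinearMap.id (σ (a + b)) = _
        rw [map_add, Tensor.tmul_add]
        exact congrArg₂ (· + ·) ha hb
  exact (tensorEvaluation_bijective hC hF hX).comp hτ

/-- Weak flat modules belong to the Auslander class. -/
theorem WeakFlat.inAuslander (hC : Semidualizing R S C) (hF : WeakFlat R F) :
    InAuslander R S C F := by
  have hbij : Function.Bijective (homothety S Rᵐᵒᵖ C) := hC.homothety_right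
  have hX := Dualizable.self hC.left_resolution hC.ext_left hbij
  refine ⟨fun i hi => ?_, fun i hi => ?_, unitMap_bijective hC.right_resolution hF hbij hX⟩
  · obtain ⟨i, rfl⟩ := Nat.exists_eq_add_of_le' hi
    exact hF.tor_subsingleton i C hC.right_resolution
  · obtain ⟨i, rfl⟩ := Nat.exists_eq_add_of_le' hi
    exact ext_tensor_subsingleton hC.right_resolution hF i C hX

end TensorEvaluation

/-! ### Hom evaluation: the counit and Tor for weak injective modules -/

section HomEvaluation

variable {R S C I : Type u} [Ring R] [Ring S] [AddCommGroup C] [Module S C] [Module Rᵐᵒᵖ C]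
  [SMulCommClass S Rᵐᵒᵖ C] [SMulCommClass Rᵐᵒᵖ S C] [AddCommGroup I] [Module S I]

section

variable {X Y : Type u} [AddCommGroup X] [Module Rᵐᵒᵖ X] [AddCommGroup Y] [Module Rᵐᵒᵖ Y]

/-- The Hom evaluation `X ⊗_R Hom_S(C, I) → Hom_S(Hom_{Rᵒᵖ}(X, C), I)`, `x ⊗ f ↦ (φ ↦ f (φ x))`. -/
noncomputable def homEvaluation (R S C I X : Type u) [Ring R] [Ring S] [AddCommGroup C]
    [Module S C] [Module Rᵐᵒᵖ C] [SMulCommClass S Rᵐᵒᵖ C] [SMulCommClass Rᵐᵒᵖ S C]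
    [AddCommGroup I] [Module S I] [AddCommGroup X] [Module Rᵐᵒᵖ X] :
    Tensor R X (HomMod R S C I) →+ ((X →ₗ[Rᵐᵒᵖ] C) →ₗ[S] I) :=
  Tensor.lift (AddMonoidHom.mk' (fun x => AddMonoidHom.mk' (fun f =>
        ({ toFun := fun φ => f.toLin (φ x)
           map_add' := fun φ ψ => map_add f.toLin (φ x) (ψ x)
           map_smul' := fun s φ => map_smul f.toLin s (φ x) } : (X →ₗ[Rᵐᵒᵖ] C) →ₗ[S] I))
        fun _ _ => rfl)
      fun x y => by
        ext f φ
        exact (congrArg f.toLin (map_add φ x y)).trans (map_add f.toLin _ _))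
    fun x r f => LinearMap.ext fun φ => congrArg f.toLin (map_smul φ (MulOpposite.op r) x)

theorem homEvaluation_mapLeft (f : X →ₗ[Rᵐᵒᵖ] Y) (t : Tensor R X (HomMod R S C I)) :
    homEvaluation R S C I Y (Tensor.mapLeft R _ f t) =
      homEvaluation R S C I X t ∘ₗ dualMap S f := by
  induction t using Tensor.induction_on with
  | zero => simp
  | tmul x g => rfl
  | add a b ha hb => rw [map_add, map_add, map_add, ha, hb, LinearMap.add_comp]

theorem homEvaluation_free_bijective (n : ℕ) :
    Function.Bijective (homEvaluation R S C I (Fin n → Rᵐᵒᵖ)) := by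
  let c (k : ((Fin n → Rᵐᵒᵖ) →ₗ[Rᵐᵒᵖ] C) →ₗ[S] I) (i : Fin n) : HomMod R S C I :=
    k ∘ₗ coordDual Rᵐᵒᵖ S C i
  let r (k : ((Fin n → Rᵐᵒᵖ) →ₗ[Rᵐᵒᵖ] C) →ₗ[S] I) : Tensor R (Fin n → Rᵐᵒᵖ) (HomMod R S C I) :=
    ∑ i, Tensor.tmul R (Pi.single i 1) (c k i)
  have hr : ∀ k k', r (k + k') = r k + r k' := fun k k' => by
    simp only [r]
    rw [← Finset.sum_add_distrib]
    exact Finset.sum_congr rfl fun i _ => Tensor.tmul_add R _ (c k i) (c k' i)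
  refine Function.bijective_iff_has_inverse.2 ⟨r, fun t => ?_, fun k => ?_⟩
  · induction t using Tensor.induction_on with
    | zero =>
      have := hr 0 0
      rw [map_zero]
      simpa using this
    | tmul x f =>
      have hc : ∀ i, c (homEvaluation R S C I _ (Tensor.tmul R x f)) i = (x i).unop • f :=
        fun i => rfl
      change ∑ i, Tensor.tmul R (Pi.single i 1) (c _ i) = _
      simp only [hc, ← Tensor.smul_tmul, MulOpposite.op_unop, ← Pi.single_smul, smul_eq_mul,
        mul_one]
      rw [← Tensor.sum_tmul, Finset.univ_sum_single]
    | add a b ha hb => rw [map_add, hr, ha, hb]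
  · ext1 φ
    rw [map_sum, LinearMap.sum_apply]
    change ∑ i, k (coordDual Rᵐᵒᵖ S C i (φ (Pi.single i 1))) = k φ
    rw [← map_sum, sum_coordDual]

/-- `X*` embeds in the dual of the free cover with cokernel `K*`, so `Ext^1(K*, I) = 0` extends `k`
to the free case. -/
theorem homEvaluation_surjective (hC : SuperFinitelyPresented S C) (hI : WeakInjective S I)
    (hX : Dualizable Rᵐᵒᵖ S C X) : Function.Surjective (homEvaluation R S C I X) := by
  intro k
  obtain ⟨n, p, hp, hK⟩ := hX.exists_free_cover hC
  have hex := LinearMap.exact_subtype_ker_map p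
  obtain ⟨k', rfl⟩ := exists_extension_of_ext_one (dualMap_injective (B := S) (C := C) hp)
    (dualMap_exact hex hp) (dualMap_surjective Subtype.val_injective hex hp (hX.ext_eq_zero 0))
    (hI _ hK.dual) k
  obtain ⟨t, rfl⟩ := (homEvaluation_free_bijective n).2 k'
  exact ⟨_, homEvaluation_mapLeft p t⟩

theorem homEvaluation_bijective (hC : SuperFinitelyPresented S C) (hI : WeakInjective S I)
    (hX : Dualizable Rᵐᵒᵖ S C X) : Function.Bijective (homEvaluation R S C I X) := by
  refine ⟨?_, homEvaluation_surjective hC hI hX⟩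
  obtain ⟨n, p, hp, hK⟩ := hX.exists_free_cover hC
  have hex := LinearMap.exact_subtype_ker_map p
  have hsurj := dualMap_surjective (B := S) Subtype.val_injective hex hp (hX.ext_eq_zero 0)
  rw [injective_iff_map_eq_zero]
  intro t ht
  obtain ⟨s, rfl⟩ := Tensor.mapLeft_surjective hp t
  rw [homEvaluation_mapLeft] at ht
  -- The evaluation of the lift `s` vanishes on `X*`, so it factors through `K*`. Surjectivity for
  -- `K` then puts `s` in the image of `K ⊗ Hom(C, I)`, which dies in `X ⊗ Hom(C, I)`.
  obtain ⟨k, hk⟩ := exists_factor_of_exact (dualMap_exact hex hp) hsurj _ ht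
  obtain ⟨z, rfl⟩ := homEvaluation_surjective hC hI hK k
  rw [← homEvaluation_mapLeft] at hk
  rw [← (homEvaluation_free_bijective n).1 hk]
  exact (Tensor.mapLeft_exact hex hp).apply_apply_eq_zero z

end

/-- In degree one, an element of `K ⊗ Hom(C, I)` that dies over the free module evaluates to a map
vanishing on the image of `(Rⁿ)* → K*`. That is all of `K*`, so the element is zero. -/
theorem tor_hom_subsingleton (hC : SuperFinitelyPresented S C) (hI : WeakInjective S I) (i : ℕ) :
    ∀ (X : Type u) [AddCommGroup X] [Module Rᵐᵒᵖ X], Dualizable Rᵐᵒᵖ S C X →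
      Subsingleton (Tor R (i + 1) X (HomMod R S C I)) := by
  induction i with
  | zero =>
    intro X _ _ hX
    obtain ⟨n, p, hp, hK⟩ := hX.exists_free_cover hC
    have hex := LinearMap.exact_subtype_ker_map p
    have hsurj := dualMap_surjective (B := S) Subtype.val_injective hex hp (hX.ext_eq_zero 0)
    refine (tor_one_subsingleton_iff hp).2 ((injective_iff_map_eq_zero _).2 fun t ht => ?_)
    refine (homEvaluation_bijective hC hI hK).1 ?_
    have := homEvaluation_mapLeft (LinearMap.ker p).subtype t
    rw [ht, map_zero] at this
    rw [map_zero]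
    exact (LinearMap.cancel_right hsurj).1 (this.symm.trans (LinearMap.zero_comp _).symm)
  | succ i ih =>
    intro X _ _ hX
    obtain ⟨n, p, hp, hK⟩ := hX.exists_free_cover hC
    exact (tor_ker_subsingleton_iff hp i).1 (ih _ hK)

/-- The counit is Hom evaluation at `X = C` followed by evaluation at the identity, a bijection
because the identity is a free generator of `Hom_{Rᵒᵖ}(C, C)` over `S`. -/
theorem counitMap_bijective (hC : SuperFinitelyPresented S C) (hI : WeakInjective S I)
    (hbij : Function.Bijective (homothety Rᵐᵒᵖ S C)) (hX : Dualizable Rᵐᵒᵖ S C C) :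
    Function.Bijective (counitMap R S C I) := by
  let e := (LinearEquiv.ofBijective _ hbij).symm
  have he : ∀ φ, e φ • (LinearMap.id : C →ₗ[Rᵐᵒᵖ] C) = φ :=
    (LinearEquiv.ofBijective _ hbij).apply_symm_apply
  have he1 : e LinearMap.id = 1 := by
    rw [LinearEquiv.symm_apply_eq]
    exact (one_smul S (LinearMap.id : C →ₗ[Rᵐᵒᵖ] C)).symm
  have hev : Function.Bijective fun k : (C →ₗ[Rᵐᵒᵖ] C) →ₗ[S] I => k LinearMap.id := by
    refine ⟨fun k k' h => LinearMap.ext fun φ => ?_, fun y => ?_⟩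
    · rw [← he φ, map_smul, map_smul]
      exact congrArg (e φ • ·) h
    · refine ⟨LinearMap.toSpanSingleton S I y ∘ₗ e.toLinearMap, ?_⟩
      change e LinearMap.id • y = y
      rw [he1, one_smul]
  have hcomp : ⇑(counitMap R S C I) =
      (fun k : (C →ₗ[Rᵐᵒᵖ] C) →ₗ[S] I => k LinearMap.id) ∘ homEvaluation R S C I C := by
    funext t
    rw [Function.comp_apply]
    induction t using Tensor.induction_on with
    | zero => rw [map_zero, map_zero, LinearMap.zero_apply]
    | tmul x f => rfl
    | add a b ha hb => rw [map_add, map_add, LinearMap.add_apply, ha, hb]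
  rw [hcomp]
  exact hev.comp (homEvaluation_bijective hC hI hX)

end HomEvaluation

/-! ### Transport between the two classes and the conclusion -/

section Bimodule

variable {R S C : Type u} [Ring R] [Ring S] [AddCommGroup C] [Module S C] [Module Rᵐᵒᵖ C]
  [SMulCommClass S Rᵐᵒᵖ C]

/-- The `R`-linear equivalence `Hom_S(C, N) ≃ Hom_S(C, N')` induced by `N ≃ N'`. -/
noncomputable def HomMod.congrRight {N N' : Type u} [AddCommGroup N] [Module S N]
    [AddCommGroup N'] [Module S N'] (e : N ≃ₗ[S] N') : HomMod R S C N ≃ₗ[R] HomMod R S C N' where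
  toFun f := e.toLinearMap ∘ₗ f.toLin
  invFun f := e.symm.toLinearMap ∘ₗ f.toLin
  map_add' f g := LinearMap.ext fun x => map_add e (f.toLin x) (g.toLin x)
  map_smul' _ _ := rfl
  left_inv f := LinearMap.ext fun x => e.symm_apply_apply (f.toLin x)
  right_inv f := LinearMap.ext fun x => e.apply_symm_apply (f.toLin x)

/-- Weak injective modules belong to the Bass class. -/
theorem WeakInjective.inBass (hC : Semidualizing R S C) {I : Type u} [AddCommGroup I]
    [Module S I] (hI : WeakInjective S I) :
    InBass R S C I := by
  -- Duality is now taken over `Rᵐᵒᵖ`, with `S` acting on the duals, so the commuting actions are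
  -- needed in the other order.
  have := SMulCommClass.symm S Rᵐᵒᵖ C
  have hbij : Function.Bijective (homothety Rᵐᵒᵖ S C) := hC.homothety_left
  have hX := Dualizable.self hC.right_resolution hC.ext_right hbij
  refine ⟨fun i hi => ?_, fun i hi => ?_, counitMap_bijective hC.left_resolution hI hbij hX⟩
  · obtain ⟨i, rfl⟩ := Nat.exists_eq_add_of_le' hi
    exact hI.ext_subsingleton i C hC.left_resolution
  · obtain ⟨i, rfl⟩ := Nat.exists_eq_add_of_le' hi
    exact tor_hom_subsingleton hC.left_resolution hI i C hX

theorem CWeakFlat.inBass_and_weakFlat (hC : Semidualizing R S C) {V : Type u} [AddCommGroup V]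
    [Module S V] (hV : CWeakFlat R S C V) : InBass R S C V ∧ WeakFlat R (HomMod R S C V) := by
  obtain ⟨F, _, _, hF, ⟨e⟩⟩ := hV
  have hA := hF.inAuslander hC
  let g : F ≃ₗ[R] HomMod R S C V :=
    (LinearEquiv.ofBijective _ hA.unit_bijective).trans (HomMod.congrRight e.symm)
  refine ⟨⟨fun i hi => ext_subsingleton_of_equiv e.symm (hA.ext_eq_zero i hi),
    fun i hi => tor_subsingleton_of_equiv g (hA.tor_eq_zero i hi), ?_⟩, hF.of_equiv g⟩
  -- The triangle identity: the counit after `C ⊗` unit is the identity, here transported along `e`.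
  have h : counitMap R S C V ∘ₗ (Tensor.congrRight S g).toLinearMap = e.symm.toLinearMap :=
    Tensor.linearMap_ext fun _ _ => rfl
  have hb : Function.Bijective (counitMap R S C V ∘ Tensor.congrRight S g) := by
    have : ⇑(counitMap R S C V) ∘ Tensor.congrRight S g = e.symm :=
      funext fun t => LinearMap.congr_fun h t
    rw [this]
    exact e.symm.bijective
  exact (Function.Bijective.of_comp_iff _ (Tensor.congrRight S g).bijective).1 hb

theorem CWeakInjective.inAuslander_and_weakInjective (hC : Semidualizing R S C) {U : Type u}
    [AddCommGroup U] [Module R U] (hU : CWeakInjective R S C U) :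
    InAuslander R S C U ∧ WeakInjective S (Tensor R C U) := by
  obtain ⟨I, _, _, hI, ⟨e⟩⟩ := hU
  have hB := hI.inBass hC
  let g : Tensor R C U ≃ₗ[S] I :=
    (Tensor.congrRight S e).trans (LinearEquiv.ofBijective _ hB.counit_bijective)
  refine ⟨⟨fun i hi => tor_subsingleton_of_equiv e.symm (hB.tor_eq_zero i hi),
    fun i hi => ext_subsingleton_of_equiv g.symm (hB.ext_eq_zero i hi), ?_⟩, hI.of_equiv g.symm⟩
  -- The other triangle identity: this composite is `e` itself, by unfolding.
  have hb : Function.Bijective ((HomMod.congrRight (R := R) (C := C) g) ∘ unitMap R S C U) :=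
    e.bijective
  exact (Function.Bijective.of_comp_iff' (HomMod.congrRight g).bijective _).1 hb

end Bimodule

end WeakFoxby

theorem proposition2p4 (R S : Type u) [Ring R] [Ring S]
    (C : Type u) [AddCommGroup C] [Module S C] [Module Rᵐᵒᵖ C] [SMulCommClass S Rᵐᵒᵖ C]
    (hC : WeakFoxby.FaithfullySemidualizing R S C) :
    (∀ (V : Type u) [AddCommGroup V] [Module S V],
      WeakFoxby.CWeakFlat R S C V ↔
        WeakFoxby.InBass R S C V ∧ WeakFoxby.WeakFlat R (WeakFoxby.HomMod R S C V)) ∧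
    (∀ (U : Type u) [AddCommGroup U] [Module R U],
      WeakFoxby.CWeakInjective R S C U ↔
        WeakFoxby.InAuslander R S C U ∧
          WeakFoxby.WeakInjective S (WeakFoxby.Tensor R C U)) := by
  refine ⟨fun V _ _ => ⟨fun hV => hV.inBass_and_weakFlat hC.toSemidualizing, ?_⟩,
    fun U _ _ => ⟨fun hU => hU.inAuslander_and_weakInjective hC.toSemidualizing, ?_⟩⟩
  · rintro ⟨hV, hF⟩
    exact ⟨WeakFoxby.HomMod R S C V, inferInstance, inferInstance, hF,
      ⟨(LinearEquiv.ofBijective _ hV.counit_bijective).symm⟩⟩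
  · rintro ⟨hU, hI⟩
    exact ⟨WeakFoxby.Tensor R C U, inferInstance, inferInstance, hI,
      ⟨LinearEquiv.ofBijective _ hU.unit_bijective⟩⟩
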